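/- **Setting.** Let $V$ be a set of $n$ users and $[k]$ a set of $k\ge 1$ channels. A conflict graph is a complete directed graph on $V$ with weights $w(u,v)\ge 0$ for $u \neq v$ (and $w(v,v)=0$). A set $U\subseteq V$ is independent if $\sum_{u\in U}w(u,v)<1$ for all $v\in U$. Let $\bar w(u,v)=w(u,v)+w(v,u)$. Let an ordering $\pi$ of $V$ and a number $\rho\ge 1/64$ be given that witness that the inductive independence number is at most $\rho$: for every $v\in V$ and every independent set $M$, $\sum_{u\in M,\ \pi(u)<\pi(v)}\bar w(u,v)\le\rho$. Every user has a non-negative symmetric valuation $b_v$, i.e. $b_v(T)=b_v(|T|)$ for $T\subseteq[k]$. An allocation $(S_v)_{v\in V}$, $S_v\subseteq[k]$, is feasible if for each channel $j$ the set $\{v: j\in S_v\}$ is independent; its social welfare is $\sum_v b_v(S_v)$. Let $b^*$ be the optimal value of the linear program $$\max \sum_{v}\sum_{i=1}^k b_v(i)x_{v,i}\quad\text{s.t.}\quad \sum_{u:\pi(u)<\pi(v)}\sum_{i=1}^k i\,\bar w(u,v)\,x_{u,i}\le\rho k\ \ (\forall v),\qquad \sum_{i=1}^k x_{v,i}\le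 1\ \ (\forall v),\qquad x\ge 0 .$$ **Algorithm.** Take any optimal solution $x$; set $x^{(1)}_{v,i}=x_{v,i}$ if $i\le k/8$ and $x^{(1)}_{v,i}=0$ otherwise, and $x^{(2)}=x-x^{(1)}$. For $l=1,2$ go through the users in increasing order of $\pi$. For each $v$, independently of all other draws, draw $d^{(l)}_v:=i$ with probability $x^{(l)}_{v,i}/(64\rho)$ for $i\in[k]$, and $d_v^{(l)}:=0$ with the remaining probability; then reset $d^{(l)}_v:=0$ if $\sum_{u:\pi(u)<\pi(v)}d^{(l)}_u\,\bar w(u,v)\ge k/32$. Let $S^{(l)}$ be the result of $\textsc{Allocate}(l)$ on $d=d^{(l)}$. Return the one of $S^{(1)},S^{(2)}$ with larger social welfare. Both procedures $\textsc{Allocate}(l)$ start with $V_0=V$ and work in rounds $t=0,1,2,\dots$ as long as $V_t\ne\emptyset$. In round $t$ a set $H_t\subseteq V_t$ is built, starting from $\emptyset$: in decreasing order of $\pi$, a user $u\in V_t$ is added to $H_t$ if $\sum_{v\in H_t}d_v\,\bar w(u,v)<k/32$ for the current $H_t$. * $\textsc{Allocate}(1)$: for all $v\in H_t$ and $j\in[k]$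 independently set $X_{v,j}=1$ with probability $8d_v/k$, else $X_{v,j}=0$. Let $Y_{v,j}=1$ if $X_{v,j}=1$ and $\sum_{u\in H_t,\,u\ne v}\bar w(u,v)X_{u,j}<1$, else $Y_{v,j}=0$. Each $v\in H_t$ with $\sum_jY_{v,j}\ge d_v$ is served: it receives an arbitrary set $S^t_v$ of $d_v$ channels $j$ with $Y_{v,j}=1$. * $\textsc{Allocate}(2)$: each $v\in H_t$ is served: it receives $S^t_v=\{1,\dots,d_v\}$. All other users have $S^t_v=\emptyset$, and $V_{t+1}$ consists of the users of $V_t$ that were not served in round $t$. The result is an allocation of maximum social welfare among the $S^t$ of all executed rounds. **Theorem.** With probability $1$ both loops stop and the algorithm returns a feasible allocation. There is a universal constant $c>0$ such that, whenever $nk>1$, the expected social welfare of the returned allocation is at least $$c\cdot\frac{b^*}{\rho\,(\log n+\log k)} .$$ Moreover, if $b_v(\emptyset)=0$ for all $v$, then $b^*$ is at least the social welfare of every feasible allocation. -/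

import Mathlib

open MeasureTheory

noncomputable section

namespace SpectrumAuction

/-- A complete directed edge-weighted conflict graph on `V`: `w u v` is the interference that `u`
creates for `v`.  There are no loops. -/
structure ConflictGraph (V : Type*) where
  w : V → V → ℝ
  nonneg : ∀ u v, 0 ≤ w u v
  loopless : ∀ v, w v v = 0

/-- An allocation gives every user a set of channels; the `k` channels are `Fin k`. -/
abbrev Allocation (V : Type*) (k : ℕ) := V → Finset (Fin k)

section Graph

variable {V : Type*}

/-- A set of users is independent if every member receives total weight less than one. -/
def ConflictGraph.IsIndependent (G : ConflictGraph V) (U : Finset V) : Prop :=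
  ∀ v ∈ U, ∑ u ∈ U, G.w u v < 1

/-- Symmetric weights. -/
def ConflictGraph.wbar (G : ConflictGraph V) (u v : V) : ℝ := G.w u v + G.w v u

variable [Fintype V]

/-- An ordering of the users: `π u` is the position of `u`. -/
abbrev Ordering (V : Type*) [Fintype V] := V ≃ Fin (Fintype.card V)

/-- The ordering `π` witnesses that the inductive independence number is at most `ρ`. -/
def ConflictGraph.InductivelyBounded (G : ConflictGraph V) (π : Ordering V) (ρ : ℝ) : Prop :=
  ∀ (v : V) (M : Finset V), G.IsIndependent M → ∑ u ∈ M with π u < π v, G.wbar u v ≤ ρ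

/-- Every channel is given to an independent set of users. -/
def ConflictGraph.IsFeasible (G : ConflictGraph V) {k : ℕ} (S : Allocation V k) : Prop :=
  ∀ j : Fin k, G.IsIndependent (Finset.univ.filter fun v => j ∈ S v)

end Graph

section Valuations

variable {V : Type*} {k : ℕ}

/-- The value of a set of channels depends only on its size. -/
def IsSymmetric (b : V → Finset (Fin k) → ℝ) : Prop :=
  ∀ v T T', T.card = T'.card → b v T = b v T'

/-- The first `i` channels. -/
def firstChannels (k i : ℕ) : Finset (Fin k) := Finset.univ.filter fun j => (j : ℕ) < i

/-- `b_v(i)`, the value of `i` channels (`i ≤ k`) under a symmetric valuation. -/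
def valueOf (b : V → Finset (Fin k) → ℝ) (v : V) (i : ℕ) : ℝ := b v (firstChannels k i)

/-- Social welfare. -/
def welfare [Fintype V] (b : V → Finset (Fin k) → ℝ) (S : Allocation V k) : ℝ := ∑ v, b v (S v)

end Valuations

section LinearProgram

variable {V : Type*} [Fintype V] {k : ℕ}

/-- Feasible solutions of the linear program; `x v i` is relevant only for `1 ≤ i ≤ k`. -/
structure LPFeasible (G : ConflictGraph V) (π : Ordering V) (ρ : ℝ) (k : ℕ)
    (x : V → ℕ → ℝ) : Prop where
  interference : ∀ v, ∑ u with π u < π v, ∑ i ∈ Finset.Icc 1 k, (i : ℝ) * G.wbar u v * x u i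
    ≤ ρ * k
  total : ∀ v, ∑ i ∈ Finset.Icc 1 k, x v i ≤ 1
  nonneg : ∀ v, ∀ i ∈ Finset.Icc 1 k, 0 ≤ x v i

/-- The objective of the linear program. -/
def lpValue (b : V → Finset (Fin k) → ℝ) (x : V → ℕ → ℝ) : ℝ :=
  ∑ v, ∑ i ∈ Finset.Icc 1 k, valueOf b v i * x v i

/-- Optimal solutions of the linear program. -/
def LPOptimal (G : ConflictGraph V) (π : Ordering V) (ρ : ℝ) (b : V → Finset (Fin k) → ℝ)
    (x : V → ℕ → ℝ) : Prop :=
  LPFeasible G π ρ k x ∧ ∀ y, LPFeasible G π ρ k y → lpValue b y ≤ lpValue b x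

end LinearProgram

section Rounding

variable {V : Type*}

/-- The part `x⁽¹⁾` of an LP solution that belongs to at most `k / 8` channels. -/
def smallPart (k : ℕ) (x : V → ℕ → ℝ) (v : V) (i : ℕ) : ℝ :=
  if (i : ℝ) ≤ (k : ℝ) / 8 then x v i else 0

/-- The remaining part `x⁽²⁾ = x - x⁽¹⁾`. -/
def largePart (k : ℕ) (x : V → ℕ → ℝ) (v : V) (i : ℕ) : ℝ := x v i - smallPart k x v i

/-- The law of one draw: `i ∈ {1, …, k}` with probability `y i / (64 ρ)`, otherwise `0`. -/
def drawLaw (k : ℕ) (ρ : ℝ) (y : ℕ → ℝ) : Measure ℕ :=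
  ENNReal.ofReal (1 - ∑ i ∈ Finset.Icc 1 k, y i / (64 * ρ)) • Measure.dirac 0
    + ∑ i ∈ Finset.Icc 1 k, ENNReal.ofReal (y i / (64 * ρ)) • Measure.dirac i

variable [Fintype V]

/-- All users in increasing order of `π`. -/
def increasing (π : Ordering V) : List V := (List.finRange (Fintype.card V)).map π.symm

/-- All users in decreasing order of `π`. -/
def decreasing (π : Ordering V) : List V := (increasing π).reverse

variable [DecidableEq V]

/-- The demands `d` obtained from the draws: in increasing order of `π`, every user `v` takes its
draw, unless the weight from the demands of its predecessors is at least `k / 32`. -/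
def demand (G : ConflictGraph V) (π : Ordering V) (k : ℕ) (draw : V → ℕ) : V → ℕ :=
  (increasing π).foldl
    (fun d v => Function.update d v
      (if (k : ℝ) / 32 ≤ ∑ u with π u < π v, (d u : ℝ) * G.wbar u v then 0 else draw v))
    (fun _ => 0)

end Rounding

section Allocate

variable {V : Type*} [Fintype V] [DecidableEq V] {k : ℕ}

/-- The set `H_t` selected greedily, in decreasing order of `π`, from the active set `A = V_t`. -/
def selected (G : ConflictGraph V) (π : Ordering V) (k : ℕ) (d : V → ℕ) (A : Finset V) :
    Finset V :=
  (decreasing π).foldl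
    (fun H u => if u ∈ A ∧ ∑ v ∈ H, (d v : ℝ) * G.wbar u v < (k : ℝ) / 32 then insert u H else H)
    ∅

/-- The number of executed rounds of a loop whose set of active users before round `t` is `A t`
(the value is `0` by convention if the loop does not stop). -/
def numRounds (A : ℕ → Finset V) : ℕ := sInf {t | A t = ∅}

/-- The best of `S 0, …, S n` (the first one of maximum welfare). -/
def bestOf (b : V → Finset (Fin k) → ℝ) (S : ℕ → Allocation V k) : ℕ → Allocation V k
  | 0 => S 0
  | n + 1 => if welfare b (bestOf b S n) < welfare b (S (n + 1)) then S (n + 1) else bestOf b S n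

/-- A rule for choosing an arbitrary subset of given size: `pick t v m A` is the `m`-element subset
of `A` used for user `v` in round `t`. -/
structure Selector (V : Type*) (k : ℕ) where
  pick : ℕ → V → ℕ → Finset (Fin k) → Finset (Fin k)
  subset : ∀ t v m A, m ≤ A.card → pick t v m A ⊆ A
  card : ∀ t v m A, m ≤ A.card → (pick t v m A).card = m

/-! Procedure `Allocate(1)`.  The number `s (v, j) ∈ [0, 1]` is the uniform random number with which
user `v` tosses its coin for channel `j`, in the current round. -/

/-- The coin `X_{v,j}`: it shows `1` with probability `8 d_v / k`. -/
def coin (d : V → ℕ) (s : V × Fin k → unitInterval) (v : V) (j : Fin k) : Prop :=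
  (s (v, j) : ℝ) < 8 * (d v : ℝ) / k

open Classical in
/-- The channels `j` with `Y_{v,j} = 1`: user `v` tentatively receives `j`, and the users of `H`
that tentatively receive `j` as well have symmetric weight less than one towards `v`. -/
def successes (G : ConflictGraph V) (d : V → ℕ) (H : Finset V) (s : V × Fin k → unitInterval)
    (v : V) : Finset (Fin k) :=
  Finset.univ.filter fun j => coin d s v j ∧
    ∑ u ∈ H.erase v, G.wbar u v * (if coin d s u j then 1 else 0) < 1

/-- The users served in a round of `Allocate(1)` with active set `A`. -/
def served (G : ConflictGraph V) (π : Ordering V) (d : V → ℕ) (A : Finset V)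
    (s : V × Fin k → unitInterval) : Finset V :=
  (selected G π k d A).filter fun v => d v ≤ (successes G d (selected G π k d A) s v).card

/-- The active sets `V_t` of `Allocate(1)`. -/
def active₁ (G : ConflictGraph V) (π : Ordering V) (d : V → ℕ)
    (s : ℕ → V × Fin k → unitInterval) : ℕ → Finset V
  | 0 => Finset.univ
  | t + 1 => active₁ G π d s t \ served G π d (active₁ G π d s t) (s t)

/-- The allocation `S^t` of `Allocate(1)`. -/
def round₁ (G : ConflictGraph V) (π : Ordering V) (σ : Selector V k) (d : V → ℕ)
    (s : ℕ → V × Fin k → unitInterval) (t : ℕ) : Allocation V k := fun v =>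
  if v ∈ served G π d (active₁ G π d s t) (s t) then
    σ.pick t v (d v) (successes G d (selected G π k d (active₁ G π d s t)) (s t) v)
  else ∅

/-- The result of `Allocate(1)`. -/
def allocate₁ (G : ConflictGraph V) (π : Ordering V) (b : V → Finset (Fin k) → ℝ)
    (σ : Selector V k) (d : V → ℕ) (s : ℕ → V × Fin k → unitInterval) : Allocation V k :=
  bestOf b (round₁ G π σ d s) (numRounds (active₁ G π d s) - 1)

/-! Procedure `Allocate(2)`. -/

/-- The active sets `V_t` of `Allocate(2)`. -/
def active₂ (G : ConflictGraph V) (π : Ordering V) (k : ℕ) (d : V → ℕ) : ℕ → Finset V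
  | 0 => Finset.univ
  | t + 1 => active₂ G π k d t \ selected G π k d (active₂ G π k d t)

/-- The allocation `S^t` of `Allocate(2)`. -/
def round₂ (G : ConflictGraph V) (π : Ordering V) (k : ℕ) (d : V → ℕ) (t : ℕ) :
    Allocation V k := fun v =>
  if v ∈ selected G π k d (active₂ G π k d t) then firstChannels k (d v) else ∅

/-- The result of `Allocate(2)`. -/
def allocate₂ (G : ConflictGraph V) (π : Ordering V) (b : V → Finset (Fin k) → ℝ)
    (d : V → ℕ) : Allocation V k :=
  bestOf b (round₂ G π k d) (numRounds (active₂ G π k d) - 1)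

end Allocate

section Algorithm

variable {V : Type*} [Fintype V] {k : ℕ}

/-- The random input: the draws for `x⁽¹⁾`, the draws for `x⁽²⁾`, and for every round of
`Allocate(1)` one number in `[0, 1]` per user and channel. -/
abbrev RandomInput (V : Type*) (k : ℕ) :=
  (V → ℕ) × (V → ℕ) × (ℕ → V × Fin k → unitInterval)

/-- The law of the random input for the LP solution `x`: all draws and tosses are independent, the
draw of user `v` for `x⁽ˡ⁾` has the law `drawLaw` of `x⁽ˡ⁾_v`, and all tosses are uniform. -/
def randomLaw (k : ℕ) (ρ : ℝ) (x : V → ℕ → ℝ) : Measure (RandomInput V k) :=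
  (Measure.pi fun v => drawLaw k ρ (smallPart k x v)).prod
    ((Measure.pi fun v => drawLaw k ρ (largePart k x v)).prod
      (Measure.infinitePi fun _ : ℕ => (volume : Measure (V × Fin k → unitInterval))))

variable [DecidableEq V]

/-- `S⁽¹⁾`. -/
def smallResult (G : ConflictGraph V) (π : Ordering V) (b : V → Finset (Fin k) → ℝ)
    (σ : Selector V k) (r : RandomInput V k) : Allocation V k :=
  allocate₁ G π b σ (demand G π k r.1) r.2.2

/-- `S⁽²⁾`. -/
def largeResult (G : ConflictGraph V) (π : Ordering V) (b : V → Finset (Fin k) → ℝ)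
    (r : RandomInput V k) : Allocation V k :=
  allocate₂ G π b (demand G π k r.2.1)

/-- The loops of `Allocate(1)` and of `Allocate(2)` both stop. -/
def Terminates (G : ConflictGraph V) (π : Ordering V) (r : RandomInput V k) : Prop :=
  (∃ t, active₁ G π (demand G π k r.1) r.2.2 t = ∅) ∧
    ∃ t, active₂ G π k (demand G π k r.2.1) t = ∅

/-- The allocation returned by the LP-rounding algorithm: the better one of `S⁽¹⁾` and `S⁽²⁾`. -/
def output (G : ConflictGraph V) (π : Ordering V) (b : V → Finset (Fin k) → ℝ)
    (σ : Selector V k) (r : RandomInput V k) : Allocation V k :=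
  if welfare b (smallResult G π b σ r) < welfare b (largeResult G π b r) then
    largeResult G π b r
  else smallResult G π b σ r

end Algorithm

end SpectrumAuction

end

/-! Up to constants, the argument loses a factor `ρ` when the LP is rounded to demands and a factor
`log n + log k` when the demands are spread over rounds.

Rounding. A draw of `v` has expected LP value `1/(64ρ)` times the share of `v`. The draws of the
predecessors of `v` put expected weight at most `k/64` on `v`, so by Markov's inequality a reset has
probability at most `1/2`, independently of the draw of `v`. Hence the demands `d` have expected
value at least `lpValue / (128ρ)` (`lpValue_le_integral_demand`).

One round. After the reset step every user with positive demand gets weight below `k/32` from its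
predecessors. Counting the weight between rejected and selected users in two ways shows that `H_t`
carries at least half of the active demand (`sum_sdiff_selected_le`), while each selected user with
positive demand gets weight below `k/16` from `H_t` (`sum_selected_lt`). For demands above `k/8`
this already makes `H_t` conflict-free on every channel. For demands up to `k/8`, a channel succeeds
for `v` with probability at least `4 d_v / k`; as channels are independent, an exponential moment
bound shows that `v` stays unserved with probability at most `1/2` (`integral_unserved_le`).

All rounds. The expected active demand therefore shrinks by `3/4` per round, starting from at most
`nk`. Being an integer, it vanishes after `O(log(nk))` rounds with probability at least `1/2`, and
the best round has at least the average value (`sum_le_mul_welfare_bestOf`). The small and large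
parts of the LP add up to `b*`, so the better result keeps at least half of the combined bound. -/

namespace SpectrumAuction

/-! ### The order in which users are processed. -/

section Lists

variable {V : Type*} [Fintype V] (π : Ordering V)

theorem mem_increasing (v : V) : v ∈ increasing π := by
  simp only [increasing, List.mem_map, List.mem_finRange, true_and]
  exact ⟨π v, π.symm_apply_apply v⟩

theorem mem_decreasing (v : V) : v ∈ decreasing π := by
  simp [decreasing, mem_increasing]

theorem increasing_pairwise : (increasing π).Pairwise fun u v => π u < π v := by
  rw [increasing, List.pairwise_map]
  simpa using List.pairwise_lt_finRange (Fintype.card V)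

theorem decreasing_pairwise : (decreasing π).Pairwise fun u v => π v < π u := by
  rw [decreasing, List.pairwise_reverse]
  exact increasing_pairwise π

end Lists

/-! ### Demands after the reset step. -/

section Demand

variable {V : Type*} [DecidableEq V]

theorem foldl_update_of_notMem {α : Type*} (f : (V → α) → V → α) (l : List V) (d : V → α) (u : V)
    (hu : u ∉ l) : l.foldl (fun d v => Function.update d v (f d v)) d u = d u := by
  induction l generalizing d with
  | nil => rfl
  | cons a l ih =>
    simp only [List.mem_cons, not_or] at hu
    rw [List.foldl_cons, ih _ hu.2, Function.update_of_ne hu.1]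

variable [Fintype V]

/-- Every entry is written once, and the test for `v` reads only entries of predecessors, which are
final by then. So the loop becomes a recursion in the final demands. -/
theorem demand_apply (G : ConflictGraph V) (π : Ordering V) (k : ℕ) (draw : V → ℕ) (v : V) :
    demand G π k draw v =
      if (k : ℝ) / 32 ≤ ∑ u with π u < π v, (demand G π k draw u : ℝ) * G.wbar u v then 0
      else draw v := by
  obtain ⟨l₁, l₂, hl⟩ := List.append_of_mem (mem_increasing π v)
  have hp := increasing_pairwise π
  rw [hl, List.pairwise_append, List.pairwise_cons] at hp
  obtain ⟨-, ⟨h2, -⟩, h12⟩ := hp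
  set f : (V → ℕ) → V → ℕ := fun d v =>
    if (k : ℝ) / 32 ≤ ∑ u with π u < π v, (d u : ℝ) * G.wbar u v then 0 else draw v with hf
  have hd : demand G π k draw =
      l₂.foldl (fun d v => Function.update d v (f d v)) (Function.update
        (l₁.foldl (fun d v => Function.update d v (f d v)) fun _ => 0) v
        (f (l₁.foldl (fun d v => Function.update d v (f d v)) fun _ => 0) v)) := by
    rw [demand, hl, List.foldl_append, List.foldl_cons]
  set d₁ := l₁.foldl (fun d v => Function.update d v (f d v)) fun _ => 0
  have hv : demand G π k draw v = f d₁ v := by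
    rw [hd, foldl_update_of_notMem, Function.update_self]
    exact fun h => (h2 v h).false
  have hlt : ∀ u, π u < π v → demand G π k draw u = d₁ u := by
    intro u hu
    rw [hd, foldl_update_of_notMem, Function.update_of_ne]
    · rintro rfl; exact hu.false
    · exact fun h => (h2 u h).not_gt hu
  rw [hv, hf]
  simp only
  rw [Finset.sum_congr rfl fun u hu => by rw [← hlt u (Finset.mem_filter.1 hu).2]]

theorem demand_le (G : ConflictGraph V) (π : Ordering V) (k : ℕ) (draw : V → ℕ) (v : V) :
    demand G π k draw v ≤ draw v := by
  rw [demand_apply]; split_ifs <;> simp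

theorem demand_eq_zero_or (G : ConflictGraph V) (π : Ordering V) (k : ℕ) (draw : V → ℕ) (v : V) :
    demand G π k draw v = 0 ∨ demand G π k draw v = draw v := by
  rw [demand_apply]; split_ifs <;> simp

/-- The property of the demands that the reset step enforces. -/
def Admissible (G : ConflictGraph V) (π : Ordering V) (k : ℕ) (d : V → ℕ) : Prop :=
  ∀ v, d v ≠ 0 → ∑ u with π u < π v, (d u : ℝ) * G.wbar u v < (k : ℝ) / 32

theorem admissible_demand (G : ConflictGraph V) (π : Ordering V) (k : ℕ) (draw : V → ℕ) :
    Admissible G π k (demand G π k draw) := by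
  intro v hv
  by_contra h
  rw [demand_apply, if_pos (not_lt.1 h)] at hv
  exact hv rfl

end Demand

section Graph

variable {V : Type*} (G : ConflictGraph V)

theorem ConflictGraph.wbar_comm (u v : V) : G.wbar u v = G.wbar v u := add_comm _ _

theorem ConflictGraph.wbar_nonneg (u v : V) : 0 ≤ G.wbar u v :=
  add_nonneg (G.nonneg _ _) (G.nonneg _ _)

theorem ConflictGraph.wbar_self (v : V) : G.wbar v v = 0 := by simp [wbar, G.loopless]

theorem ConflictGraph.w_le_wbar (u v : V) : G.w u v ≤ G.wbar u v :=
  le_add_of_nonneg_right (G.nonneg _ _)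

/-- A set in which every member receives symmetric weight less than one is independent. -/
theorem ConflictGraph.isIndependent_of_wbar {U : Finset V}
    (h : ∀ v ∈ U, ∑ u ∈ U, G.wbar u v < 1) : G.IsIndependent U := fun v hv =>
  (Finset.sum_le_sum fun u _ => G.w_le_wbar u v).trans_lt (h v hv)

end Graph

/-! ### The greedy set: it has half of the demand and low internal weight. -/

section Selected

variable {V : Type*} [DecidableEq V]

theorem mem_foldl_insert_of_notMem (p : Finset V → V → Prop) [∀ H u, Decidable (p H u)]
    (l : List V) (H : Finset V) (u : V) (hu : u ∉ l) :
    u ∈ l.foldl (fun H u => if p H u then insert u H else H) H ↔ u ∈ H := by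
  induction l generalizing H with
  | nil => rfl
  | cons a l ih =>
    simp only [List.mem_cons, not_or] at hu
    rw [List.foldl_cons, ih _ hu.2]
    split_ifs <;> simp [hu.1]

theorem mem_foldl_insert_imp (p : Finset V → V → Prop) [∀ H u, Decidable (p H u)]
    (l : List V) (H : Finset V) (u : V)
    (hu : u ∈ l.foldl (fun H u => if p H u then insert u H else H) H) : u ∈ H ∨ u ∈ l := by
  by_contra! h
  exact h.1 ((mem_foldl_insert_of_notMem p l H u h.2).1 hu)

variable [Fintype V]

/-- When `v` is tested, the current set consists exactly of the finally selected users after `v` in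
`π`, so the test can be read off the final set. -/
theorem mem_selected_iff (G : ConflictGraph V) (π : Ordering V) (k : ℕ) (d : V → ℕ)
    (A : Finset V) (v : V) :
    v ∈ selected G π k d A ↔ v ∈ A ∧
      ∑ u ∈ selected G π k d A with π v < π u, (d u : ℝ) * G.wbar u v < (k : ℝ) / 32 := by
  obtain ⟨l₁, l₂, hl⟩ := List.append_of_mem (mem_decreasing π v)
  have hp := decreasing_pairwise π
  rw [hl, List.pairwise_append, List.pairwise_cons] at hp
  obtain ⟨-, ⟨h2, -⟩, h12⟩ := hp
  set p : Finset V → V → Prop := fun H u =>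
    u ∈ A ∧ ∑ v ∈ H, (d v : ℝ) * G.wbar u v < (k : ℝ) / 32 with hpdef
  have hd : selected G π k d A =
      l₂.foldl (fun H u => if p H u then insert u H else H)
        (if p (l₁.foldl (fun H u => if p H u then insert u H else H) ∅) v then
          insert v (l₁.foldl (fun H u => if p H u then insert u H else H) ∅)
        else l₁.foldl (fun H u => if p H u then insert u H else H) ∅) := by
    rw [selected, hl, List.foldl_append, List.foldl_cons]
  set H₁ := l₁.foldl (fun H u => if p H u then insert u H else H) ∅ with hH₁
  have hH₁mem : ∀ u ∈ H₁, π v < π u := by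
    intro u hu
    rcases mem_foldl_insert_imp p l₁ ∅ u hu with h | h
    · simp at h
    · exact h12 u h v (by simp)
  have hfil : (selected G π k d A).filter (fun u => π v < π u) = H₁ := by
    ext u
    rw [Finset.mem_filter]
    constructor
    · rintro ⟨hu, hlt⟩
      rw [hd, mem_foldl_insert_of_notMem] at hu
      · have hne : u ≠ v := by rintro rfl; exact hlt.false
        split_ifs at hu
        · simpa [hne] using hu
        · exact hu
      · exact fun h => (h2 u h).not_gt hlt
    · intro hu
      have hlt := hH₁mem u hu
      refine ⟨?_, hlt⟩
      rw [hd, mem_foldl_insert_of_notMem]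
      · split_ifs
        · exact Finset.mem_insert_of_mem hu
        · exact hu
      · exact fun h => (h2 u h).not_gt hlt
  rw [hfil]
  have hv : v ∉ H₁ := fun h => (hH₁mem v h).false
  rw [hd, mem_foldl_insert_of_notMem _ _ _ _ fun h => (h2 v h).false]
  have hcomm : ∑ u ∈ H₁, (d u : ℝ) * G.wbar u v = ∑ u ∈ H₁, (d u : ℝ) * G.wbar v u :=
    Finset.sum_congr rfl fun u _ => by rw [G.wbar_comm]
  rw [hcomm]
  split_ifs with h
  · simpa using h
  · exact iff_of_false hv h

variable (G : ConflictGraph V) (π : Ordering V) (k : ℕ) (d : V → ℕ) (A : Finset V)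

theorem selected_subset : selected G π k d A ⊆ A := fun v hv =>
  ((mem_selected_iff G π k d A v).1 hv).1

theorem selected_eq_of_sum_eq_zero {k : ℕ} (hk : 0 < k) (h : ∑ v ∈ A, d v = 0) :
    selected G π k d A = A := by
  refine (selected_subset G π k d A).antisymm fun v hv => ?_
  rw [mem_selected_iff]
  refine ⟨hv, ?_⟩
  rw [Finset.sum_eq_zero]
  · positivity
  · intro u hu
    have := (Finset.sum_eq_zero_iff.1 h) u
      (selected_subset G π k d A (Finset.mem_filter.1 hu).1)
    simp [this]

/-- Every selected user with a positive demand receives little weight from the selected users. -/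
theorem sum_selected_lt {d : V → ℕ} (hd : Admissible G π k d) {v : V}
    (hv : v ∈ selected G π k d A) (hdv : d v ≠ 0) :
    ∑ u ∈ selected G π k d A, (d u : ℝ) * G.wbar u v < (k : ℝ) / 16 := by
  set H := selected G π k d A with hH
  have h1 := ((mem_selected_iff G π k d A v).1 hv).2
  rw [← hH] at h1
  have h2 := hd v hdv
  -- The selected users not after `v` are its predecessors and `v` itself, which contributes nothing
  -- as there are no loops; admissibility bounds the rest.
  have h3 : ∑ u ∈ H with ¬ π v < π u, (d u : ℝ) * G.wbar u v
      ≤ ∑ u with π u < π v, (d u : ℝ) * G.wbar u v := by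
    have : ∑ u ∈ H with ¬ π v < π u, (d u : ℝ) * G.wbar u v
        = ∑ u ∈ H with π u < π v, (d u : ℝ) * G.wbar u v := by
      symm
      refine Finset.sum_subset ?_ ?_
      · intro u hu
        rw [Finset.mem_filter] at hu ⊢
        exact ⟨hu.1, hu.2.not_gt⟩
      · intro u hu hu'
        rw [Finset.mem_filter] at hu hu'
        have : u = v := π.injective (le_antisymm (not_lt.1 hu.2)
          (not_lt.1 fun h => hu' ⟨hu.1, h⟩))
        rw [this, G.wbar_self, mul_zero]
    rw [this]
    refine Finset.sum_le_sum_of_subset_of_nonneg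
      (Finset.filter_subset_filter _ (Finset.subset_univ _)) fun u _ _ => ?_
    exact mul_nonneg (Nat.cast_nonneg _) (G.wbar_nonneg _ _)
  rw [← Finset.sum_filter_add_sum_filter_not H (fun u => π v < π u)]
  linarith

/-- The selected users have at least half of the total demand. -/
theorem sum_sdiff_selected_le {k : ℕ} (hk : 0 < k) {d : V → ℕ} (hd : Admissible G π k d) :
    ∑ v ∈ A \ selected G π k d A, (d v : ℝ) ≤ ∑ v ∈ selected G π k d A, (d v : ℝ) := by
  set H := selected G π k d A with hH
  have hk' : (0 : ℝ) < k / 32 := by positivity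
  have hnn : ∀ u v, 0 ≤ (d u : ℝ) * G.wbar u v := fun u v =>
    mul_nonneg (Nat.cast_nonneg _) (G.wbar_nonneg _ _)
  refine le_of_mul_le_mul_right ?_ hk'
  -- Double counting: a rejected user receives at least `k/32` from later selected users, and a
  -- selected user with positive demand receives less than `k/32` from its predecessors. Symmetry of
  -- `wbar` identifies the two sums.
  calc (∑ v ∈ A \ H, (d v : ℝ)) * (k / 32)
      ≤ ∑ v ∈ A \ H, (d v : ℝ) * ∑ u ∈ H with π v < π u, (d u : ℝ) * G.wbar u v := by
        rw [Finset.sum_mul]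
        refine Finset.sum_le_sum fun v hv => mul_le_mul_of_nonneg_left ?_ (Nat.cast_nonneg _)
        rw [Finset.mem_sdiff] at hv
        by_contra! h
        exact hv.2 ((mem_selected_iff G π k d A v).2 ⟨hv.1, h⟩)
    _ = ∑ u ∈ H, (d u : ℝ) * ∑ v ∈ A \ H with π v < π u, (d v : ℝ) * G.wbar v u := by
        simp only [Finset.sum_filter, Finset.mul_sum]
        rw [Finset.sum_comm]
        refine Finset.sum_congr rfl fun u _ => Finset.sum_congr rfl fun v _ => ?_
        split_ifs
        · rw [G.wbar_comm u v]; ring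
        · simp
    _ ≤ ∑ u ∈ H, (d u : ℝ) * (k / 32) := by
        refine Finset.sum_le_sum fun u _ => ?_
        rcases eq_or_ne (d u) 0 with h | h
        · simp [h]
        refine mul_le_mul_of_nonneg_left (le_trans ?_ (hd u h).le) (Nat.cast_nonneg _)
        exact Finset.sum_le_sum_of_subset_of_nonneg
          (Finset.filter_subset_filter _ (Finset.subset_univ _)) fun v _ _ => hnn v u
    _ = (∑ u ∈ H, (d u : ℝ)) * (k / 32) := by rw [Finset.sum_mul]

end Selected

/-! ### The best round against the average round. -/

section Best

variable {V : Type*} [Fintype V] {k : ℕ} (b : V → Finset (Fin k) → ℝ) (S : ℕ → Allocation V k)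

theorem bestOf_mem (n : ℕ) : ∃ t ≤ n, bestOf b S n = S t := by
  induction n with
  | zero => exact ⟨0, le_rfl, rfl⟩
  | succ n ih =>
    rw [bestOf]
    split_ifs
    · exact ⟨n + 1, le_rfl, rfl⟩
    · obtain ⟨t, ht, h⟩ := ih
      exact ⟨t, ht.trans n.le_succ, h⟩

theorem welfare_le_bestOf {n t : ℕ} (ht : t ≤ n) : welfare b (S t) ≤ welfare b (bestOf b S n) := by
  induction n with
  | zero => rw [Nat.le_zero.1 ht]; rfl
  | succ n ih =>
    rw [bestOf]
    rcases Nat.lt_or_eq_of_le ht with h | rfl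
    · have := ih (Nat.lt_succ_iff.1 h)
      split_ifs with h'
      · exact this.trans h'.le
      · exact this
    · split_ifs with h'
      · exact le_rfl
      · exact not_lt.1 h'

theorem welfare_nonneg {b : V → Finset (Fin k) → ℝ} (hb : ∀ v T, 0 ≤ b v T)
    (S : Allocation V k) : 0 ≤ welfare b S := Finset.sum_nonneg fun v _ => hb v _

/-- If the active sets `A` shrink by removing served users, and a user served in a round has value
at least `f v` in that round, then the best round has at least the average value. -/
theorem sum_le_mul_welfare_bestOf {b : V → Finset (Fin k) → ℝ} (hb : ∀ v T, 0 ≤ b v T)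
    (A : ℕ → Finset V) (hA0 : A 0 = Finset.univ) (f : V → ℝ)
    (hf : ∀ t, ∀ v ∈ A t, v ∉ A (t + 1) → f v ≤ b v (S t v)) {T : ℕ} (hT : A (T + 1) = ∅) :
    ∑ v, f v ≤ (T + 1) * welfare b (bestOf b S (numRounds A - 1)) := by
  have hn : numRounds A ≤ T + 1 := Nat.sInf_le hT
  have hAn : A (numRounds A) = ∅ := Nat.sInf_mem (s := {t | A t = ∅}) ⟨_, hT⟩
  -- Truncated subtraction is harmless: `numRounds A = 0` would force `V` to be empty.
  set n := numRounds A - 1 with hndef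
  have hserved : ∀ v, ∃ t ≤ n, f v ≤ b v (S t v) := by
    intro v
    by_contra! h
    have key : ∀ t, t ≤ n + 1 → v ∈ A t := by
      intro t
      induction t with
      | zero => intro _; rw [hA0]; exact Finset.mem_univ v
      | succ t ih =>
        intro ht
        by_contra hv
        exact (h t (by omega)).not_ge (hf t v (ih (by omega)) hv)
    have := key (numRounds A) (by omega)
    rw [hAn] at this
    simp at this
  calc ∑ v, f v ≤ ∑ v, ∑ t ∈ Finset.range (n + 1), b v (S t v) := by
        refine Finset.sum_le_sum fun v _ => ?_
        obtain ⟨t, ht, h⟩ := hserved v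
        exact h.trans (Finset.single_le_sum (f := fun t => b v (S t v)) (fun t _ => hb v _)
          (Finset.mem_range.2 (by omega)))
    _ = ∑ t ∈ Finset.range (n + 1), welfare b (S t) := Finset.sum_comm
    _ ≤ ∑ t ∈ Finset.range (n + 1), welfare b (bestOf b S n) := by
        refine Finset.sum_le_sum fun t ht => welfare_le_bestOf b S ?_
        rw [Finset.mem_range] at ht; omega
    _ = ((n + 1 : ℕ) : ℝ) * welfare b (bestOf b S n) := by simp
    _ ≤ (T + 1) * welfare b (bestOf b S n) := by
        refine mul_le_mul_of_nonneg_right ?_ (welfare_nonneg hb _)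
        exact_mod_cast (by omega : n + 1 ≤ T + 1)

end Best

section Symmetric

variable {V : Type*} {k : ℕ}

theorem card_firstChannels {i : ℕ} (h : i ≤ k) : (firstChannels k i).card = i := by
  rw [firstChannels, Fin.card_filter_val_lt, min_eq_right h]

theorem IsSymmetric.eq_valueOf {b : V → Finset (Fin k) → ℝ} (hb : IsSymmetric b) (v : V)
    (T : Finset (Fin k)) : b v T = valueOf b v T.card :=
  hb v _ _ (card_firstChannels (by simpa using T.card_le_univ)).symm

end Symmetric

/-! ### Feasibility and progress of both procedures. -/

section Rounds

variable {V : Type*} [Fintype V] [DecidableEq V] {k : ℕ} (G : ConflictGraph V) (π : Ordering V)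

omit [Fintype V] in
open Classical in
theorem mem_successes (d : V → ℕ) (H : Finset V) (s : V × Fin k → unitInterval) (v : V)
    (j : Fin k) : j ∈ successes G d H s v ↔ coin d s v j ∧
      ∑ u ∈ H.erase v, G.wbar u v * (if coin d s u j then 1 else 0) < 1 := by
  simp [successes]

open Classical in
-- A channel is kept only if it survives the conflict test against all tentative holders in `H_t`,
-- and these include all final holders.
theorem allocate₁_feasible (b : V → Finset (Fin k) → ℝ) (σ : Selector V k) (d : V → ℕ)
    (s : ℕ → V × Fin k → unitInterval) : G.IsFeasible (allocate₁ G π b σ d s) := by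
  obtain ⟨t, -, ht⟩ := bestOf_mem b (round₁ G π σ d s) (numRounds (active₁ G π d s) - 1)
  rw [allocate₁, ht]
  intro j
  set A := active₁ G π d s t
  have hmem : ∀ v, j ∈ round₁ G π σ d s t v →
      v ∈ selected G π k d A ∧ j ∈ successes G d (selected G π k d A) (s t) v := by
    intro v hv
    rw [round₁] at hv
    split_ifs at hv with h
    · rw [served, Finset.mem_filter] at h
      exact ⟨h.1, σ.subset t v _ _ h.2 hv⟩
    · simp at hv
  refine G.isIndependent_of_wbar fun v hv => ?_
  rw [Finset.mem_filter] at hv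
  have h := (hmem v hv.2).2
  rw [mem_successes] at h
  refine lt_of_le_of_lt ?_ h.2
  rw [← Finset.sum_erase (a := v) (f := fun u => G.wbar u v) _ (G.wbar_self v)]
  have : ∀ u ∈ (Finset.univ.filter fun v => j ∈ round₁ G π σ d s t v).erase v,
      G.wbar u v = G.wbar u v * (if coin d (s t) u j then 1 else 0) := by
    intro u hu
    rw [Finset.mem_erase, Finset.mem_filter] at hu
    have := (hmem u hu.2.2).2
    rw [mem_successes] at this
    rw [if_pos this.1, mul_one]
  rw [Finset.sum_congr rfl this]
  refine Finset.sum_le_sum_of_subset_of_nonneg ?_ fun u _ _ => ?_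
  · intro u hu
    rw [Finset.mem_erase, Finset.mem_filter] at hu
    exact Finset.mem_erase.2 ⟨hu.1, (hmem u hu.2.2).1⟩
  · exact mul_nonneg (G.wbar_nonneg _ _) (by split_ifs <;> simp)

/-- The demands obtained from `x⁽²⁾`: they are zero or more than `k / 8`. -/
theorem allocate₂_feasible (hk : 0 < k) (b : V → Finset (Fin k) → ℝ) {d : V → ℕ}
    (hd : Admissible G π k d) (hd' : ∀ v, d v ≠ 0 → (k : ℝ) / 8 < d v) :
    G.IsFeasible (allocate₂ G π b d) := by
  obtain ⟨t, -, ht⟩ := bestOf_mem b (round₂ G π k d) (numRounds (active₂ G π k d) - 1)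
  rw [allocate₂, ht]
  intro j
  set A := active₂ G π k d t
  have hmem : ∀ v, j ∈ round₂ G π k d t v → v ∈ selected G π k d A ∧ d v ≠ 0 := by
    intro v hv
    rw [round₂] at hv
    split_ifs at hv with h
    · refine ⟨h, ?_⟩
      rw [firstChannels, Finset.mem_filter] at hv
      omega
    · simp at hv
  refine G.isIndependent_of_wbar fun v hv => ?_
  obtain ⟨hvH, hvd⟩ := hmem v (Finset.mem_filter.1 hv).2
  have h1 := sum_selected_lt G π k A hd hvH hvd
  have hk' : (0 : ℝ) < k := by exact_mod_cast hk
  -- Every user on channel `j` has demand above `k/8`, so a total weighted demand below `k/16`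
  -- leaves symmetric weight below `1/2`.
  have h2 : (∑ u with j ∈ round₂ G π k d t u, G.wbar u v) * (k / 8)
      ≤ ∑ u ∈ selected G π k d A, (d u : ℝ) * G.wbar u v := by
    rw [Finset.sum_mul]
    calc ∑ u with j ∈ round₂ G π k d t u, G.wbar u v * (k / 8)
        ≤ ∑ u with j ∈ round₂ G π k d t u, (d u : ℝ) * G.wbar u v := by
          refine Finset.sum_le_sum fun u hu => ?_
          rw [mul_comm]
          exact mul_le_mul_of_nonneg_right (hd' u (hmem u (Finset.mem_filter.1 hu).2).2).le
            (G.wbar_nonneg _ _)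
      _ ≤ _ := Finset.sum_le_sum_of_subset_of_nonneg
          (fun u hu => (hmem u (Finset.mem_filter.1 hu).2).1)
          fun u _ _ => mul_nonneg (Nat.cast_nonneg _) (G.wbar_nonneg _ _)
  nlinarith

theorem sum_valueOf_le_allocate₁ {b : V → Finset (Fin k) → ℝ} (hb : ∀ v T, 0 ≤ b v T)
    (hs : IsSymmetric b) (σ : Selector V k) (d : V → ℕ) (s : ℕ → V × Fin k → unitInterval)
    {T : ℕ} (hT : active₁ G π d s (T + 1) = ∅) :
    ∑ v, valueOf b v (d v) ≤ (T + 1) * welfare b (allocate₁ G π b σ d s) := by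
  refine sum_le_mul_welfare_bestOf _ hb _ rfl _ (fun t v hv hv' => ?_) hT
  have h : v ∈ served G π d (active₁ G π d s t) (s t) := by
    by_contra h
    exact hv' (Finset.mem_sdiff.2 ⟨hv, h⟩)
  rw [round₁, if_pos h, hs.eq_valueOf, σ.card]
  exact (Finset.mem_filter.1 h).2

theorem sum_valueOf_le_allocate₂ {b : V → Finset (Fin k) → ℝ} (hb : ∀ v T, 0 ≤ b v T)
    (d : V → ℕ) {T : ℕ} (hT : active₂ G π k d (T + 1) = ∅) :
    ∑ v, valueOf b v (d v) ≤ (T + 1) * welfare b (allocate₂ G π b d) := by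
  refine sum_le_mul_welfare_bestOf _ hb _ rfl _ (fun t v hv hv' => ?_) hT
  have h : v ∈ selected G π k d (active₂ G π k d t) := by
    by_contra h
    exact hv' (Finset.mem_sdiff.2 ⟨hv, h⟩)
  rw [round₂, if_pos h, valueOf]

/-- Users with demand zero need no success, but they must still be selected. Once only they remain,
one more round serves them all; this is the `+ 1` in the round counts. -/
theorem active₁_succ_eq_empty (hk : 0 < k) (d : V → ℕ) (s : ℕ → V × Fin k → unitInterval) {t : ℕ}
    (h : ∑ v ∈ active₁ G π d s t, d v = 0) : active₁ G π d s (t + 1) = ∅ := by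
  rw [active₁, Finset.sdiff_eq_empty_iff_subset, served,
    selected_eq_of_sum_eq_zero G π d _ hk h]
  intro v hv
  rw [Finset.mem_filter]
  exact ⟨hv, by simp [(Finset.sum_eq_zero_iff.1 h) v hv]⟩

theorem active₂_succ_eq_empty (hk : 0 < k) (d : V → ℕ) {t : ℕ}
    (h : ∑ v ∈ active₂ G π k d t, d v = 0) : active₂ G π k d (t + 1) = ∅ := by
  rw [active₂, Finset.sdiff_eq_empty_iff_subset, selected_eq_of_sum_eq_zero G π d _ hk h]

theorem sum_active₂_le (hk : 0 < k) {d : V → ℕ} (hd : Admissible G π k d) (t : ℕ) :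
    ∑ v ∈ active₂ G π k d t, (d v : ℝ) ≤ (1 / 2) ^ t * ∑ v, (d v : ℝ) := by
  induction t with
  | zero => simp [active₂]
  | succ t ih =>
    set A := active₂ G π k d t
    have h1 := sum_sdiff_selected_le G π A hk hd
    have h2 := Finset.sum_sdiff (f := fun v => (d v : ℝ)) (selected_subset G π k d A)
    have h3 : active₂ G π k d (t + 1) = A \ selected G π k d A := rfl
    rw [h3, pow_succ]
    linarith

end Rounds

/-! ### The linear program: splitting and relaxation. -/

section LP

variable {V : Type*} {k : ℕ}

theorem smallPart_nonneg {x : V → ℕ → ℝ} {v : V} {i : ℕ} (h : 0 ≤ x v i) :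
    0 ≤ smallPart k x v i := by
  rw [smallPart]; split_ifs <;> simp [h]

theorem smallPart_le {x : V → ℕ → ℝ} {v : V} {i : ℕ} (h : 0 ≤ x v i) :
    smallPart k x v i ≤ x v i := by
  rw [smallPart]; split_ifs <;> simp [h]

variable [Fintype V]

theorem lpValue_small_add_large (b : V → Finset (Fin k) → ℝ) (x : V → ℕ → ℝ) :
    lpValue b (smallPart k x) + lpValue b (largePart k x) = lpValue b x := by
  simp only [lpValue, ← Finset.sum_add_distrib]
  refine Finset.sum_congr rfl fun v _ => Finset.sum_congr rfl fun i _ => ?_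
  rw [← mul_add, largePart, add_sub_cancel]

/-- Feasibility is inherited by smaller vectors. -/
theorem LPFeasible.mono {G : ConflictGraph V} {π : Ordering V} {ρ : ℝ} {x y : V → ℕ → ℝ}
    (hx : LPFeasible G π ρ k x) (h0 : ∀ v, ∀ i ∈ Finset.Icc 1 k, 0 ≤ y v i)
    (h : ∀ v, ∀ i ∈ Finset.Icc 1 k, y v i ≤ x v i) : LPFeasible G π ρ k y where
  interference v := (Finset.sum_le_sum fun u _ => Finset.sum_le_sum fun i hi =>
    mul_le_mul_of_nonneg_left (h u i hi)
      (mul_nonneg (Nat.cast_nonneg _) (G.wbar_nonneg _ _))).trans (hx.interference v)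
  total v := (Finset.sum_le_sum (h v)).trans (hx.total v)
  nonneg := h0

theorem LPFeasible.smallPart {G : ConflictGraph V} {π : Ordering V} {ρ : ℝ} {x : V → ℕ → ℝ}
    (hx : LPFeasible G π ρ k x) : LPFeasible G π ρ k (smallPart k x) :=
  hx.mono (fun v i hi => smallPart_nonneg (hx.nonneg v i hi))
    fun v i hi => smallPart_le (hx.nonneg v i hi)

theorem LPFeasible.largePart {G : ConflictGraph V} {π : Ordering V} {ρ : ℝ} {x : V → ℕ → ℝ}
    (hx : LPFeasible G π ρ k x) : LPFeasible G π ρ k (largePart k x) :=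
  hx.mono (fun v i hi => sub_nonneg.2 (smallPart_le (hx.nonneg v i hi)))
    fun v i hi => sub_le_self _ (smallPart_nonneg (hx.nonneg v i hi))

/-- The linear program is a relaxation of the allocation problem. -/
theorem welfare_le_lpValue {G : ConflictGraph V} {π : Ordering V} {ρ : ℝ}
    (hG : G.InductivelyBounded π ρ) {b : V → Finset (Fin k) → ℝ} (hs : IsSymmetric b)
    (h0 : ∀ v, b v ∅ = 0) {x : V → ℕ → ℝ} (hx : LPOptimal G π ρ b x) {S : Allocation V k}
    (hS : G.IsFeasible S) : welfare b S ≤ lpValue b x := by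
  have hcard : ∀ v, (S v).card ≤ k := fun v => by simpa using (S v).card_le_univ
  -- The 0-1 solution of `S`. An empty bundle has no LP variable, which is why `b v ∅ = 0` is
  -- needed.
  set y : V → ℕ → ℝ := fun v i => if i = (S v).card then 1 else 0 with hy
  have hsum : ∀ (v : V) (f : ℕ → ℝ), f 0 = 0 →
      ∑ i ∈ Finset.Icc 1 k, f i * y v i = f (S v).card := by
    intro v f hf
    simp only [hy, mul_ite, mul_one, mul_zero, Finset.sum_ite_eq', Finset.mem_Icc]
    split_ifs with h
    · rfl
    · have : (S v).card = 0 := by have := hcard v; omega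
      rw [this, hf]
  have hval : lpValue b y = welfare b S := by
    refine Finset.sum_congr rfl fun v _ => ?_
    rw [hsum v (valueOf b v), hs.eq_valueOf]
    rw [← h0 v, hs.eq_valueOf v ∅, Finset.card_empty]
  rw [← hval]
  refine hx.2 y ⟨fun v => ?_, fun v => ?_, fun v i _ => ?_⟩
  · have h1 : ∀ u, ∑ i ∈ Finset.Icc 1 k, (i : ℝ) * G.wbar u v * y u i
        = ∑ j : Fin k, if j ∈ S u then G.wbar u v else 0 := by
      intro u
      rw [hsum u (fun i => (i : ℝ) * G.wbar u v) (by simp), Finset.sum_ite_mem]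
      simp
    simp only [h1]
    rw [Finset.sum_comm]
    -- Counted channel by channel, the holders of each channel form an independent set and
    -- contribute at most `ρ`.
    calc ∑ j : Fin k, ∑ u with π u < π v, (if j ∈ S u then G.wbar u v else 0)
        ≤ ∑ j : Fin k, ρ := by
          refine Finset.sum_le_sum fun j _ => ?_
          refine le_trans (le_of_eq ?_) (hG v _ (hS j))
          rw [← Finset.sum_filter, Finset.filter_filter, Finset.filter_filter]
          simp only [and_comm]
      _ = ρ * k := by simp [mul_comm]
  · have : ∑ i ∈ Finset.Icc 1 k, y v i ≤ ∑ i ∈ Finset.range (k + 1), y v i :=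
      Finset.sum_le_sum_of_subset_of_nonneg (fun i hi => by
        rw [Finset.mem_Icc] at hi; rw [Finset.mem_range]; omega)
        fun i _ _ => by simp only [hy]; split_ifs <;> simp
    refine this.trans ?_
    simp only [hy, Finset.sum_ite_eq']
    split_ifs <;> simp
  · simp only [hy]; split_ifs <;> simp

end LP

/-! ### The law of a single draw. -/

section Draw

open ProbabilityTheory

variable {k : ℕ} {ρ : ℝ} {y : ℕ → ℝ}

theorem integral_drawLaw (hρ : 0 < ρ) (h0 : ∀ i ∈ Finset.Icc 1 k, 0 ≤ y i)
    (h1 : ∑ i ∈ Finset.Icc 1 k, y i / (64 * ρ) ≤ 1) (f : ℕ → ℝ) :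
    ∫ n, f n ∂drawLaw k ρ y = (1 - ∑ i ∈ Finset.Icc 1 k, y i / (64 * ρ)) * f 0
      + ∑ i ∈ Finset.Icc 1 k, y i / (64 * ρ) * f i := by
  have hint : ∀ (c : ℝ) (n : ℕ), Integrable f (ENNReal.ofReal c • Measure.dirac n) := fun c n =>
    (integrable_dirac (by simp)).smul_measure ENNReal.ofReal_ne_top
  rw [drawLaw, integral_add_measure (hint _ _)
    (integrable_finsetSum_measure.2 fun i _ => hint _ _),
    integral_finsetSum_measure fun i _ => hint _ _]
  simp only [integral_smul_measure, integral_dirac, smul_eq_mul]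
  rw [ENNReal.toReal_ofReal (sub_nonneg.2 h1)]
  congr 1
  refine Finset.sum_congr rfl fun i hi => ?_
  rw [ENNReal.toReal_ofReal (div_nonneg (h0 i hi) (by positivity))]

theorem integrable_drawLaw (f : ℕ → ℝ) : Integrable f (drawLaw k ρ y) := by
  have hint : ∀ (c : ℝ) (n : ℕ), Integrable f (ENNReal.ofReal c • Measure.dirac n) := fun c n =>
    (integrable_dirac (by simp)).smul_measure ENNReal.ofReal_ne_top
  exact (hint _ _).add_measure (integrable_finsetSum_measure.2 fun i _ => hint _ _)

theorem isProbabilityMeasure_drawLaw (hρ : 0 < ρ) (h0 : ∀ i ∈ Finset.Icc 1 k, 0 ≤ y i)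
    (h1 : ∑ i ∈ Finset.Icc 1 k, y i / (64 * ρ) ≤ 1) : IsProbabilityMeasure (drawLaw k ρ y) := by
  constructor
  rw [drawLaw]
  simp only [Measure.coe_add, Pi.add_apply, Measure.smul_apply, measure_univ, smul_eq_mul, mul_one,
    Measure.coe_finsetSum, Finset.sum_apply]
  rw [← ENNReal.ofReal_sum_of_nonneg fun i hi => div_nonneg (h0 i hi) (by positivity),
    ← ENNReal.ofReal_add (sub_nonneg.2 h1)
      (Finset.sum_nonneg fun i hi => div_nonneg (h0 i hi) (by positivity))]
  simp

theorem ae_drawLaw (p : ℕ → Prop) (hp0 : p 0)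
    (hp : ∀ i ∈ Finset.Icc 1 k, y i ≠ 0 → p i) : ∀ᵐ n ∂drawLaw k ρ y, p n := by
  have hdirac : ∀ (c : ENNReal) (n : ℕ), p n → (c • Measure.dirac n) {m | ¬ p m} = 0 := by
    intro c n hn
    simp [hn]
  rw [ae_iff, drawLaw]
  simp only [Measure.coe_add, Pi.add_apply, Measure.coe_finsetSum, Finset.sum_apply,
    add_eq_zero, Finset.sum_eq_zero_iff]
  refine ⟨hdirac _ _ hp0, fun i hi => ?_⟩
  rcases eq_or_ne (y i) 0 with h | h
  · simp [h]
  · exact hdirac _ _ (hp i hi h)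

end Draw

/-! ### Expected value of the demands. -/

section Demand

open ProbabilityTheory

variable {V : Type*} [Fintype V] {k : ℕ} {ρ : ℝ}
  {G : ConflictGraph V} {π : Ordering V} {y : V → ℕ → ℝ}

/-- Here `ρ ≥ 1/64` guarantees that the draw probabilities sum to at most one. -/
theorem LPFeasible.sum_div_le (hy : LPFeasible G π ρ k y) (hρ : 1 / 64 ≤ ρ) (v : V) :
    ∑ i ∈ Finset.Icc 1 k, y v i / (64 * ρ) ≤ 1 := by
  rw [← Finset.sum_div, div_le_one (by linarith)]
  linarith [hy.total v]

theorem LPFeasible.isProbabilityMeasure (hy : LPFeasible G π ρ k y) (hρ : 1 / 64 ≤ ρ) (v : V) :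
    IsProbabilityMeasure (drawLaw k ρ (y v)) :=
  isProbabilityMeasure_drawLaw (by linarith) (hy.nonneg v) (hy.sum_div_le hρ v)

variable [DecidableEq V]

theorem integral_valueOf_demand_single (hk : 0 < k) (hρ : 1 / 64 ≤ ρ)
    (hy : LPFeasible G π ρ k y) {b : V → Finset (Fin k) → ℝ} (hb : ∀ v T, 0 ≤ b v T)
    (hint : ∀ v, Integrable (fun r => valueOf b v (demand G π k r v))
      (Measure.pi fun v => drawLaw k ρ (y v))) (v : V) :
    (∑ i ∈ Finset.Icc 1 k, valueOf b v i * y v i) / (128 * ρ) ≤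
      ∫ r, valueOf b v (demand G π k r v) ∂Measure.pi fun v => drawLaw k ρ (y v) := by
  have hρ0 : 0 < ρ := by linarith
  have hk' : (0 : ℝ) < k := by exact_mod_cast hk
  have := fun v => hy.isProbabilityMeasure hρ v
  set μ := Measure.pi fun v => drawLaw k ρ (y v) with hμ
  -- The value at `0` may be positive but is not counted by the LP, so it is dropped.
  set g : ℕ → ℝ := fun n => if n ∈ Finset.Icc 1 k then valueOf b v n else 0 with hg
  have hg0 : ∀ n, 0 ≤ g n := fun n => by simp only [hg]; split_ifs <;> simp [valueOf, hb]
  have hgle : ∀ n, g n ≤ valueOf b v n := fun n => by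
    simp only [hg]; split_ifs <;> simp [valueOf, hb]
  have hev : ∀ (u : V) (f : ℕ → ℝ), Integrable (fun r => f (r u)) μ := fun u f =>
    (measurePreserving_eval (fun v => drawLaw k ρ (y v)) u).integrable_comp_of_integrable
      (integrable_drawLaw f)
  have hev' : ∀ (u : V) (f : ℕ → ℝ), ∫ r, f (r u) ∂μ = ∫ n, f n ∂drawLaw k ρ (y u) := fun u f =>
    integral_comp_eval (μ := fun v => drawLaw k ρ (y v)) (i := u) (f := f)
      (integrable_drawLaw f).aestronglyMeasurable
  have hind : iIndepFun (fun u (r : V → ℕ) => r u) μ :=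
    iIndepFun_pi (X := fun _ n => n) fun _ => measurable_id.aemeasurable
  have hI2 : ∀ u, u ≠ v → Integrable (fun r : V → ℕ => g (r v) * (r u : ℝ)) μ := fun u hu =>
    ((hind.indepFun hu.symm).comp (measurable_from_nat (f := g))
      (measurable_from_nat (f := fun n : ℕ => (n : ℝ)))).integrable_mul (hev v g) (hev u _)
  have hE2 : ∀ u, u ≠ v → ∫ r : V → ℕ, g (r v) * (r u : ℝ) ∂μ
      = (∫ n, g n ∂drawLaw k ρ (y v)) * ∫ n : ℕ, (n : ℝ) ∂drawLaw k ρ (y u) := by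
    intro u hu
    rw [← hev', ← hev' u fun n => (n : ℝ)]
    exact ((hind.indepFun hu.symm).comp (measurable_from_nat (f := g))
      (measurable_from_nat (f := fun n : ℕ => (n : ℝ)))).integral_mul_eq_mul_integral
      (hev v g).aestronglyMeasurable (hev u _).aestronglyMeasurable
  -- Pointwise Markov inequality: after a reset the subtracted sum is at least `g (r v)`. It uses
  -- the draws of the predecessors instead of their demands, so each summand is a product of
  -- independent factors.
  have hpoint : ∀ r : V → ℕ,
      g (r v) - ∑ u with π u < π v, 32 / k * G.wbar u v * (g (r v) * r u)
        ≤ valueOf b v (demand G π k r v) := by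
    intro r
    have hsum : ∑ u with π u < π v, 32 / k * G.wbar u v * (g (r v) * r u)
        = g (r v) * (32 / k * ∑ u with π u < π v, (r u : ℝ) * G.wbar u v) := by
      rw [Finset.mul_sum, Finset.mul_sum]
      exact Finset.sum_congr rfl fun u _ => by ring
    have hle : ∑ u with π u < π v, (demand G π k r u : ℝ) * G.wbar u v
        ≤ ∑ u with π u < π v, (r u : ℝ) * G.wbar u v :=
      Finset.sum_le_sum fun u _ => mul_le_mul_of_nonneg_right
        (by exact_mod_cast demand_le G π k r u) (G.wbar_nonneg u v)
    rw [hsum, demand_apply]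
    split_ifs with h
    · have h1 : 1 ≤ 32 / (k : ℝ) * ∑ u with π u < π v, (r u : ℝ) * G.wbar u v := by
        rw [div_mul_eq_mul_div, le_div_iff₀ hk']
        linarith
      have h2 : 0 ≤ valueOf b v 0 := hb _ _
      nlinarith [hg0 (r v)]
    · have h1 : 0 ≤ 32 / (k : ℝ) * ∑ u with π u < π v, (r u : ℝ) * G.wbar u v :=
        mul_nonneg (by positivity) (Finset.sum_nonneg fun u _ =>
          mul_nonneg (Nat.cast_nonneg _) (G.wbar_nonneg u v))
      nlinarith [hg0 (r v), hgle (r v)]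
  have hne : ∀ u ∈ Finset.univ.filter (fun u => π u < π v), u ≠ v := by
    rintro u hu rfl
    exact (Finset.mem_filter.1 hu).2.false
  have hIs : Integrable
      (fun r : V → ℕ => ∑ u with π u < π v, 32 / k * G.wbar u v * (g (r v) * r u)) μ :=
    integrable_finsetSum _ fun u hu => (hI2 u (hne u hu)).const_mul _
  have hgE : ∫ n, g n ∂drawLaw k ρ (y v)
      = (∑ i ∈ Finset.Icc 1 k, valueOf b v i * y v i) / (64 * ρ) := by
    rw [integral_drawLaw hρ0 (hy.nonneg v) (hy.sum_div_le hρ v), Finset.sum_div]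
    have : g 0 = 0 := by simp [hg]
    rw [this, mul_zero, zero_add]
    refine Finset.sum_congr rfl fun i hi => ?_
    simp only [hg, if_pos hi]
    ring
  have hnE : ∀ u, ∫ n : ℕ, (n : ℝ) ∂drawLaw k ρ (y u)
      = (∑ i ∈ Finset.Icc 1 k, (i : ℝ) * y u i) / (64 * ρ) := by
    intro u
    rw [integral_drawLaw hρ0 (hy.nonneg u) (hy.sum_div_le hρ u), Finset.sum_div]
    simp only [Nat.cast_zero, mul_zero, zero_add]
    exact Finset.sum_congr rfl fun i _ => by ring
  have hgE0 : 0 ≤ ∫ n, g n ∂drawLaw k ρ (y v) := integral_nonneg hg0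
  calc (∑ i ∈ Finset.Icc 1 k, valueOf b v i * y v i) / (128 * ρ)
      = (∫ n, g n ∂drawLaw k ρ (y v)) * (1 / 2) := by rw [hgE]; field_simp; ring
    _ ≤ (∫ n, g n ∂drawLaw k ρ (y v)) *
        (1 - 32 / k * ((∑ u with π u < π v, ∑ i ∈ Finset.Icc 1 k, (i : ℝ) * G.wbar u v * y u i)
          / (64 * ρ))) := by
        refine mul_le_mul_of_nonneg_left ?_ hgE0
        have h := hy.interference v
        have : 32 / (k : ℝ) * ((∑ u with π u < π v, ∑ i ∈ Finset.Icc 1 k,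
            (i : ℝ) * G.wbar u v * y u i) / (64 * ρ)) ≤ 32 / k * (ρ * k / (64 * ρ)) := by
          gcongr
        -- Expected predecessor weight at most `k/64` against the threshold `k/32`.
        have h2 : 32 / (k : ℝ) * (ρ * k / (64 * ρ)) = 1 / 2 := by field_simp; norm_num
        linarith
    _ = ∫ r, (g (r v) - ∑ u with π u < π v, 32 / k * G.wbar u v * (g (r v) * r u)) ∂μ := by
        rw [integral_sub (hev v g) hIs, integral_finsetSum _ fun u hu =>
          (hI2 u (hne u hu)).const_mul _, hev', mul_sub, mul_one, Finset.sum_div, Finset.mul_sum,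
          Finset.mul_sum]
        congr 1
        refine Finset.sum_congr rfl fun u hu => ?_
        rw [integral_const_mul, hE2 u (hne u hu), hnE, Finset.sum_div, Finset.sum_div,
          Finset.mul_sum, Finset.mul_sum, Finset.mul_sum, Finset.mul_sum]
        exact Finset.sum_congr rfl fun i _ => by ring
    _ ≤ ∫ r, valueOf b v (demand G π k r v) ∂μ :=
        integral_mono ((hev v g).sub hIs) (hint v) hpoint

omit [DecidableEq V] in
theorem ae_draw (hρ : 1 / 64 ≤ ρ) (hy : LPFeasible G π ρ k y) (p : ℕ → Prop) (hp0 : p 0)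
    (hp : ∀ v, ∀ i ∈ Finset.Icc 1 k, y v i ≠ 0 → p i) :
    ∀ᵐ r ∂Measure.pi fun v => drawLaw k ρ (y v), ∀ v, p (r v) := by
  have := fun v => hy.isProbabilityMeasure hρ v
  rw [Filter.eventually_all]
  intro v
  exact (Measure.tendsto_eval_ae_ae (μ := fun v => drawLaw k ρ (y v)) (i := v)).eventually
    (ae_drawLaw p hp0 (hp v))

theorem ae_demand (hρ : 1 / 64 ≤ ρ) (hy : LPFeasible G π ρ k y) (p : ℕ → Prop) (hp0 : p 0)
    (hp : ∀ v, ∀ i ∈ Finset.Icc 1 k, y v i ≠ 0 → p i) :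
    ∀ᵐ r ∂Measure.pi fun v => drawLaw k ρ (y v), ∀ v, p (demand G π k r v) := by
  filter_upwards [ae_draw hρ hy p hp0 hp] with r hr v
  rcases demand_eq_zero_or G π k r v with h | h
  · rwa [h]
  · rw [h]; exact hr v

theorem integrable_comp_demand (hρ : 1 / 64 ≤ ρ) (hy : LPFeasible G π ρ k y) (f : ℕ → ℝ)
    (v : V) : Integrable (fun r => f (demand G π k r v))
      (Measure.pi fun v => drawLaw k ρ (y v)) := by
  have := fun v => hy.isProbabilityMeasure hρ v
  refine Integrable.of_bound (measurable_of_countable _).aestronglyMeasurable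
    (∑ i ∈ Finset.range (k + 1), ‖f i‖) ?_
  filter_upwards [ae_demand hρ hy (fun n => n ≤ k) (Nat.zero_le k)
    fun _ i hi _ => (Finset.mem_Icc.1 hi).2] with r hr
  exact Finset.single_le_sum (f := fun i => ‖f i‖) (fun _ _ => norm_nonneg _)
    (Finset.mem_range.2 (Nat.lt_succ_of_le (hr v)))

/-- The expected value of the demands is at least a constant fraction of the value of the LP
solution, divided by `ρ`. -/
theorem lpValue_le_integral_demand (hk : 0 < k) (hρ : 1 / 64 ≤ ρ)
    (hy : LPFeasible G π ρ k y) {b : V → Finset (Fin k) → ℝ} (hb : ∀ v T, 0 ≤ b v T) :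
    lpValue b y / (128 * ρ) ≤
      ∫ r, ∑ v, valueOf b v (demand G π k r v) ∂Measure.pi fun v => drawLaw k ρ (y v) := by
  have hint := fun v => integrable_comp_demand (G := G) (π := π) hρ hy (valueOf b v) v
  rw [integral_finsetSum _ fun v _ => hint v, lpValue, Finset.sum_div]
  exact Finset.sum_le_sum fun v _ => integral_valueOf_demand_single hk hρ hy hb hint v

end Demand

/-! ### Independence across channels. -/

section Columns

open ProbabilityTheory

/-- The columns of an array of independent random variables are independent. -/
theorem iIndepFun_columns {ι κ X : Type*} [Fintype ι] [Fintype κ] [MeasurableSpace X]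
    (μ : Measure X) [IsProbabilityMeasure μ] :
    iIndepFun (fun (j : κ) (s : ι × κ → X) (i : ι) => s (i, j)) (Measure.pi fun _ => μ) := by
  rw [iIndepFun_iff_map_fun_eq_infinitePi_map (by fun_prop), ← Measure.infinitePi_eq_pi]
  have h1 : ∀ j : κ, (Measure.infinitePi fun _ : ι × κ => μ).map (fun s i => s (i, j))
      = Measure.infinitePi fun _ : ι => μ := fun j =>
    Measure.map_infinitePi_infinitePi_of_inj (P := fun _ : ι × κ => μ) (f := fun i : ι => (i, j))
      fun a b h => (Prod.mk.inj h).1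
  -- Swapping the indices puts the column index first, so that currying yields the family of
  -- columns.
  have h2 : (Measure.infinitePi fun _ : ι × κ => μ).map (fun s (p : κ × ι) => s p.swap)
      = Measure.infinitePi fun _ : κ × ι => μ :=
    Measure.map_infinitePi_infinitePi_of_inj (P := fun _ : ι × κ => μ) Prod.swap_injective
  simp only [h1]
  rw [← Measure.infinitePi_map_curry (fun (_ : κ) (_ : ι) => μ), ← h2,
    Measure.map_map (by fun_prop) (by fun_prop)]
  rfl

end Columns

/-! ### One round of `Allocate(1)`. -/

section Coins

open ProbabilityTheory

variable {V : Type*} [Fintype V] {k : ℕ}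

omit [Fintype V] in
theorem measurable_coin (d : V → ℕ) (v : V) (j : Fin k) :
    MeasurableSet {s : V × Fin k → unitInterval | coin d s v j} := by
  unfold coin
  exact measurableSet_lt (by fun_prop) measurable_const

open Classical in
theorem integral_threshold {q : ℝ} (h0 : 0 ≤ q) (h1 : q ≤ 1) :
    ∫ t : unitInterval, (if (t : ℝ) < q then (1 : ℝ) else 0) = q := by
  have : (fun t : unitInterval => if (t : ℝ) < q then (1 : ℝ) else 0)
      = (Set.Iio (⟨q, h0, h1⟩ : unitInterval)).indicator 1 := by
    ext t
    simp [Set.indicator_apply, ← Subtype.coe_lt_coe]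
  rw [this, integral_indicator_one measurableSet_Iio, measureReal_def, unitInterval.volume_Iio,
    ENNReal.toReal_ofReal h0]

open Classical in
-- The split of the LP at `k/8` ensures that `8 d_v / k` is a probability.
theorem integral_coin (d : V → ℕ) (v : V) (j : Fin k) (hd : (d v : ℝ) ≤ k / 8) :
    ∫ s : V × Fin k → unitInterval, (if coin d s v j then (1 : ℝ) else 0) = 8 * d v / k := by
  have hk : (0 : ℝ) < k := by exact_mod_cast j.pos
  have h := integral_comp_eval (μ := fun _ : V × Fin k => (volume : Measure unitInterval))
    (i := (v, j)) (f := fun t : unitInterval => if (t : ℝ) < 8 * d v / k then (1 : ℝ) else 0)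
    (Measurable.ite (measurableSet_lt (by fun_prop) measurable_const) measurable_const
      measurable_const).aestronglyMeasurable
  rw [integral_threshold (by positivity) (by rw [div_le_one hk]; linarith)] at h
  exact h

open Classical in
theorem integrable_coin (d : V → ℕ) (v : V) (j : Fin k) :
    Integrable fun s : V × Fin k → unitInterval => if coin d s v j then (1 : ℝ) else 0 :=
  Integrable.of_bound (Measurable.ite (measurable_coin d v j) measurable_const
    measurable_const).aestronglyMeasurable 1 (.of_forall fun s => by split_ifs <;> simp)

open Classical in
theorem indepFun_coin (d : V → ℕ) {u v : V} (huv : u ≠ v) (j : Fin k) :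
    IndepFun (fun s : V × Fin k → unitInterval => if coin d s u j then (1 : ℝ) else 0)
      (fun s => if coin d s v j then (1 : ℝ) else 0) volume := by
  have hind : iIndepFun (fun p (s : V × Fin k → unitInterval) => s p) volume :=
    iIndepFun_pi (X := fun _ t => t) fun _ => measurable_id.aemeasurable
  have hm : ∀ q : ℝ, Measurable fun t : unitInterval => if (t : ℝ) < q then (1 : ℝ) else 0 :=
    fun q => Measurable.ite (measurableSet_lt (by fun_prop) measurable_const) measurable_const
      measurable_const
  exact (hind.indepFun (i := (u, j)) (j := (v, j)) (by simpa using huv)).comp (hm (8 * d u / k))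
    (hm (8 * d v / k))

variable [DecidableEq V] (G : ConflictGraph V) (π : Ordering V)

omit [Fintype V] in
theorem measurable_successes (d : V → ℕ) (H : Finset V) (v : V) :
    Measurable fun s : V × Fin k → unitInterval => successes G d H s v := by
  classical
  rw [measurable_finset_iff]
  intro j
  simp only [mem_successes]
  refine (measurableSet_setOfPred.1 (measurable_coin d v j)).and
    (measurableSet_setOfPred.1 (measurableSet_lt ?_ measurable_const))
  exact Finset.measurable_fun_sum _ fun u _ => (Measurable.ite (measurable_coin d u j)
    measurable_const measurable_const).const_mul _

/-- The factor `1 - Y_{v,j} / 2` of channel `j`. -/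
noncomputable def halving (d : V → ℕ) (H : Finset V) (v : V) (j : Fin k) (s : V × Fin k → unitInterval) : ℝ :=
  if j ∈ successes G d H s v then 1 / 2 else 1

omit [Fintype V] in
theorem measurable_halving (d : V → ℕ) (H : Finset V) (v : V) (j : Fin k) :
    Measurable (halving G d H v j) :=
  Measurable.ite (measurableSet_setOfPred.2 (measurable_finset_iff.1 (measurable_successes G d H v) j))
    measurable_const measurable_const

omit [Fintype V] in
theorem halving_nonneg (d : V → ℕ) (H : Finset V) (v : V) (j : Fin k)
    (s : V × Fin k → unitInterval) : 0 ≤ halving G d H v j s := by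
  rw [halving]; split_ifs <;> norm_num

omit [Fintype V] in
theorem halving_le_one (d : V → ℕ) (H : Finset V) (v : V) (j : Fin k)
    (s : V × Fin k → unitInterval) : halving G d H v j s ≤ 1 := by
  rw [halving]; split_ifs <;> norm_num

theorem integrable_halving (d : V → ℕ) (H : Finset V) (v : V) (j : Fin k) :
    Integrable (halving G d H v j) :=
  Integrable.of_bound (measurable_halving G d H v j).aestronglyMeasurable 1
    (.of_forall fun s => by
      rw [Real.norm_of_nonneg (halving_nonneg G d H v j s)]; exact halving_le_one G d H v j s)

open Classical in
-- Given `X_{v,j} = 1`, the expected conflicting weight is at most `(8/k)(k/16) = 1/2`, so the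
-- success probability is at least `4 d_v / k`; the factor `1 - Y/2` halves this.
theorem integral_halving_le {d : V → ℕ} {H : Finset V} {v : V} (hd : ∀ u, (d u : ℝ) ≤ k / 8)
    (hH : ∑ u ∈ H, (d u : ℝ) * G.wbar u v ≤ k / 16) (j : Fin k) :
    ∫ s, halving G d H v j s ≤ 1 - 2 * d v / k := by
  have hk : (0 : ℝ) < k := by exact_mod_cast j.pos
  set X : V → (V × Fin k → unitInterval) → ℝ := fun u s => if coin d s u j then 1 else 0 with hX
  have hIX : ∀ u, Integrable (X u) := fun u => integrable_coin d u j
  have hIXX : ∀ u ∈ H.erase v, Integrable fun s => X u s * X v s := fun u hu =>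
    (indepFun_coin d (Finset.ne_of_mem_erase hu) j).integrable_mul (hIX u) (hIX v)
  have hEXX : ∀ u ∈ H.erase v, ∫ s, X u s * X v s = 8 * d u / k * (8 * d v / k) := by
    intro u hu
    rw [← integral_coin d u j (hd u), ← integral_coin d v j (hd v)]
    exact (indepFun_coin d (Finset.ne_of_mem_erase hu) j).integral_mul_eq_mul_integral
      (hIX u).aestronglyMeasurable (hIX v).aestronglyMeasurable
  -- If `X_{v,j} = 1` but the channel fails, the conflicting weight is at least one and cancels
  -- `X_{v,j}`.
  have hpoint : ∀ s, halving G d H v j s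
      ≤ 1 - (1 / 2) * (X v s - ∑ u ∈ H.erase v, G.wbar u v * (X u s * X v s)) := by
    intro s
    have hsum : ∑ u ∈ H.erase v, G.wbar u v * (X u s * X v s)
        = (∑ u ∈ H.erase v, G.wbar u v * X u s) * X v s := by
      rw [Finset.sum_mul]; exact Finset.sum_congr rfl fun u _ => by ring
    have h0 : 0 ≤ ∑ u ∈ H.erase v, G.wbar u v * X u s := Finset.sum_nonneg fun u _ =>
      mul_nonneg (G.wbar_nonneg _ _) (by simp only [hX]; split_ifs <;> norm_num)
    rw [hsum, halving]
    by_cases hc : coin d s v j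
    · have hv : X v s = 1 := by simp [hX, hc]
      rw [hv]
      split_ifs with h
      · linarith
      · have : 1 ≤ ∑ u ∈ H.erase v, G.wbar u v * X u s := by
          by_contra! h'
          exact h ((mem_successes G d H s v j).2 ⟨hc, h'⟩)
        linarith
    · have hv : X v s = 0 := by simp [hX, hc]
      rw [hv, if_neg fun h => hc ((mem_successes G d H s v j).1 h).1]
      linarith
  have hIs : Integrable fun s => ∑ u ∈ H.erase v, G.wbar u v * (X u s * X v s) :=
    integrable_finsetSum _ fun u hu => (hIXX u hu).const_mul _
  have hId : Integrable fun s =>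
      (1 / 2 : ℝ) * (X v s - ∑ u ∈ H.erase v, G.wbar u v * (X u s * X v s)) :=
    ((hIX v).sub hIs).const_mul (1 / 2)
  have hle := integral_mono (integrable_halving G d H v j) ((integrable_const 1).sub hId) hpoint
  refine hle.trans ?_
  have hE : ∫ s, (1 - (1 / 2) * (X v s - ∑ u ∈ H.erase v, G.wbar u v * (X u s * X v s)))
      = 1 - (1 / 2) * (8 * d v / k - ∑ u ∈ H.erase v, G.wbar u v *
        (8 * d u / k * (8 * d v / k))) := by
    rw [integral_sub (integrable_const 1) hId,
      integral_const_mul, integral_sub (hIX v) hIs,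
      integral_finsetSum _ fun u hu => (hIXX u hu).const_mul _]
    congr 2
    · simp
    · congr 1
      · exact integral_coin d v j (hd v)
      · exact Finset.sum_congr rfl fun u hu => by rw [integral_const_mul, hEXX u hu]
  refine (le_of_eq hE).trans ?_
  have hs : ∑ u ∈ H.erase v, G.wbar u v * (8 * d u / k * (8 * d v / k))
      ≤ (1 / 2) * (8 * d v / k) := by
    have : ∑ u ∈ H.erase v, G.wbar u v * (8 * d u / k * (8 * d v / k))
        = (8 * d v / k) * (8 / k * ∑ u ∈ H.erase v, (d u : ℝ) * G.wbar u v) := by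
      rw [Finset.mul_sum, Finset.mul_sum]; exact Finset.sum_congr rfl fun u _ => by ring
    rw [this, mul_comm (1 / 2 : ℝ), Finset.sum_erase _ (by rw [G.wbar_self, mul_zero])]
    refine mul_le_mul_of_nonneg_left ?_ (by positivity)
    calc 8 / (k : ℝ) * ∑ u ∈ H, (d u : ℝ) * G.wbar u v ≤ 8 / k * (k / 16) := by gcongr
      _ = 1 / 2 := by field_simp; norm_num
  have : 2 * (d v : ℝ) / k = 1 / 4 * (8 * d v / k) := by ring
  rw [this]
  linarith

/-- The factor of channel `j` is the same function `F` of column `j` of the tosses, and the columns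
are independent. -/
theorem integral_prod_halving (d : V → ℕ) (H : Finset V) (v : V) :
    ∫ s : V × Fin k → unitInterval, ∏ j, halving G d H v j s
      = ∏ j, ∫ s : V × Fin k → unitInterval, halving G d H v j s := by
  classical
  set F : (V → unitInterval) → ℝ := fun c =>
    if (c v : ℝ) < 8 * (d v : ℝ) / k ∧
      ∑ u ∈ H.erase v, G.wbar u v * (if (c u : ℝ) < 8 * (d u : ℝ) / k then 1 else 0) < 1
    then 1 / 2 else 1 with hF
  have hm : ∀ u, MeasurableSet {c : V → unitInterval | (c u : ℝ) < 8 * (d u : ℝ) / k} := fun u =>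
    measurableSet_lt (by fun_prop) measurable_const
  have hFm : Measurable F := by
    refine Measurable.ite (measurableSet_setOfPred.2 ((measurableSet_setOfPred.1 (hm v)).and
      (measurableSet_setOfPred.1 (measurableSet_lt ?_ measurable_const)))) measurable_const
      measurable_const
    exact Finset.measurable_fun_sum _ fun u _ => (Measurable.ite (hm u)
      measurable_const measurable_const).const_mul _
  have h : ∀ (j : Fin k) (s : V × Fin k → unitInterval), halving G d H v j s = F fun u => s (u, j) := by
    intro j s
    simp only [halving, hF, mem_successes, coin]
    congr!
  simp only [h]
  exact (iIndepFun_columns (ι := V) (κ := Fin k) (volume : Measure unitInterval)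
    ).integral_fun_prod_comp (f := fun _ => F)
      (fun j => (measurable_pi_lambda _ fun i => measurable_pi_apply (i, j)).aemeasurable)
    fun j => hFm.aestronglyMeasurable

/-- A user that is selected remains unserved with probability at most `1 / 2`. -/
theorem integral_unserved_le {d : V → ℕ} {H : Finset V} {v : V} (hd : ∀ u, (d u : ℝ) ≤ k / 8)
    (hH : d v ≠ 0 → ∑ u ∈ H, (d u : ℝ) * G.wbar u v ≤ k / 16) :
    ∫ s : V × Fin k → unitInterval, (if d v ≤ (successes G d H s v).card then (0 : ℝ) else 1)
      ≤ 1 / 2 := by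
  rcases eq_or_ne (d v) 0 with h0 | h0
  · simp [h0]
  have hdv : (1 : ℝ) ≤ d v := by exact_mod_cast Nat.one_le_iff_ne_zero.2 h0
  have hk : (0 : ℝ) < k := by have := hd v; linarith
  have hprod : ∀ s : V × Fin k → unitInterval,
      ∏ j, halving G d H v j s = (1 / 2) ^ (successes G d H s v).card := by
    intro s
    simp only [halving]
    rw [Finset.prod_ite, Finset.prod_const, Finset.prod_const_one, mul_one,
      Finset.filter_univ_mem]
  -- Exponential Markov inequality: an unserved user has at most `d v - 1` successes.
  have hpoint : ∀ s : V × Fin k → unitInterval,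
      (if d v ≤ (successes G d H s v).card then (0 : ℝ) else 1)
        ≤ 2 ^ (d v - 1) * ∏ j, halving G d H v j s := by
    intro s
    rw [hprod]
    split_ifs with h
    · positivity
    · obtain ⟨m, hm⟩ := Nat.exists_eq_add_of_le (show (successes G d H s v).card ≤ d v - 1 by omega)
      rw [hm, pow_add, mul_right_comm, ← mul_pow]
      norm_num
      exact one_le_pow₀ (by norm_num)
  have hIp : Integrable fun s : V × Fin k → unitInterval => ∏ j, halving G d H v j s := by
    refine Integrable.of_bound (Finset.measurable_fun_prod _ fun j _ =>
      measurable_halving G d H v j).aestronglyMeasurable 1 (.of_forall fun s => ?_)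
    rw [Real.norm_of_nonneg (Finset.prod_nonneg fun j _ => halving_nonneg G d H v j s)]
    exact Finset.prod_le_one (fun j _ => halving_nonneg G d H v j s)
      fun j _ => halving_le_one G d H v j s
  have h1 : ∫ s : V × Fin k → unitInterval,
      (if d v ≤ (successes G d H s v).card then (0 : ℝ) else 1)
      ≤ ∫ s, 2 ^ (d v - 1) * ∏ j, halving G d H v j s :=
    integral_mono_of_nonneg (.of_forall fun s => by dsimp; split_ifs <;> simp)
      (hIp.const_mul _) (.of_forall hpoint)
  refine h1.trans ?_
  rw [integral_const_mul, integral_prod_halving]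
  have h2 : ∏ j : Fin k, ∫ s : V × Fin k → unitInterval, halving G d H v j s
      ≤ ∏ _j : Fin k, Real.exp (-(2 * d v / k)) :=
    Finset.prod_le_prod (fun j _ => integral_nonneg fun s => halving_nonneg G d H v j s)
      fun j _ => (integral_halving_le G hd (hH h0) j).trans (by
        have := Real.add_one_le_exp (-(2 * (d v : ℝ) / k)); linarith)
  have h3 : ∏ _j : Fin k, Real.exp (-(2 * d v / k)) = Real.exp (-2) ^ d v := by
    rw [Finset.prod_const, Finset.card_univ, Fintype.card_fin, ← Real.exp_nat_mul,
      ← Real.exp_nat_mul]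
    congr 1
    field_simp
  rw [h3] at h2
  -- This crude bound suffices, since `2 ^ (d - 1) * (1 / 2) ^ d = 1 / 2`.
  have h4 : Real.exp (-2) ≤ 1 / 2 := by
    rw [Real.exp_neg, one_div]
    exact inv_anti₀ (by norm_num) (by have := Real.add_one_le_exp (2 : ℝ); linarith)
  calc (2 : ℝ) ^ (d v - 1) * ∏ j : Fin k, ∫ s : V × Fin k → unitInterval, halving G d H v j s
      ≤ 2 ^ (d v - 1) * (1 / 2) ^ d v := by
        refine mul_le_mul_of_nonneg_left (h2.trans ?_) (by positivity)
        gcongr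
    _ = 1 / 2 := by
        obtain ⟨m, hm⟩ := Nat.exists_eq_succ_of_ne_zero h0
        rw [hm, Nat.succ_sub_one, pow_succ, ← mul_assoc, ← mul_pow]
        norm_num

theorem measurable_served (d : V → ℕ) (A : Finset V) :
    Measurable fun s : V × Fin k → unitInterval => served G π d A s := by
  rw [measurable_finset_iff]
  intro v
  simp only [served, Finset.mem_filter]
  exact (measurable_of_countable fun T : Finset (Fin k) =>
    v ∈ selected G π k d A ∧ d v ≤ T.card).comp (measurable_successes G d _ v)

/-- In every round of `Allocate(1)` the total demand of the active users decreases by a constant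
factor in expectation. -/
theorem integral_sum_sdiff_served_le (hk : 0 < k) {d : V → ℕ} (hd : Admissible G π k d)
    (hd' : ∀ u, (d u : ℝ) ≤ k / 8) (A : Finset V) :
    ∫ s : V × Fin k → unitInterval, ∑ v ∈ A \ served G π d A s, (d v : ℝ)
      ≤ 3 / 4 * ∑ v ∈ A, (d v : ℝ) := by
  set H := selected G π k d A with hHdef
  have hIind : ∀ v, Integrable fun s : V × Fin k → unitInterval =>
      if d v ≤ (successes G d H s v).card then (0 : ℝ) else 1 := fun v =>
    Integrable.of_bound ((measurable_of_countable fun T : Finset (Fin k) =>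
      if d v ≤ T.card then (0 : ℝ) else 1).comp
        (measurable_successes G d _ v)).aestronglyMeasurable 1
      (.of_forall fun s => by split_ifs <;> simp)
  have hsplit : ∀ s : V × Fin k → unitInterval, ∑ v ∈ A \ served G π d A s, (d v : ℝ)
      = ∑ v ∈ A \ H, (d v : ℝ)
        + ∑ v ∈ H, (d v : ℝ) * (if d v ≤ (successes G d H s v).card then (0 : ℝ) else 1) := by
    intro s
    have h1 : ∑ v ∈ H, (d v : ℝ) * (if d v ≤ (successes G d H s v).card then (0 : ℝ) else 1)
        = ∑ v ∈ H \ served G π d A s, (d v : ℝ) := by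
      rw [Finset.sdiff_eq_filter, Finset.sum_filter]
      refine Finset.sum_congr rfl fun v hv => ?_
      have hiff : v ∈ served G π d A s ↔ d v ≤ (successes G d H s v).card := by
        rw [served, Finset.mem_filter, ← hHdef]
        exact and_iff_right hv
      simp only [hiff]
      split_ifs <;> simp
    have h2 : A \ served G π d A s = (A \ H) ∪ (H \ served G π d A s) := by
      ext v
      have h3 : v ∈ served G π d A s → v ∈ H := fun h => (Finset.mem_filter.1 h).1
      have h4 : v ∈ H → v ∈ A := fun h => selected_subset G π k d A h
      simp only [Finset.mem_union, Finset.mem_sdiff]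
      tauto
    rw [h1, h2, Finset.sum_union]
    exact Finset.disjoint_left.2 fun v hv hv' =>
      (Finset.mem_sdiff.1 hv).2 (Finset.mem_sdiff.1 hv').1
  simp only [hsplit]
  rw [integral_add (integrable_const _)
      (integrable_finsetSum _ fun v _ => (hIind v).const_mul _),
    integral_finsetSum _ fun v _ => (hIind v).const_mul _]
  have h1 : ∑ v ∈ H, ∫ s : V × Fin k → unitInterval,
      (d v : ℝ) * (if d v ≤ (successes G d H s v).card then (0 : ℝ) else 1)
      ≤ ∑ v ∈ H, (d v : ℝ) * (1 / 2) := by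
    refine Finset.sum_le_sum fun v hv => ?_
    rw [integral_const_mul]
    exact mul_le_mul_of_nonneg_left (integral_unserved_le G hd'
      fun h0 => (sum_selected_lt G π k A hd hv h0).le) (Nat.cast_nonneg _)
  rw [← Finset.sum_mul] at h1
  have h2 := sum_sdiff_selected_le G π A hk hd
  have h3 := Finset.sum_sdiff (f := fun v => (d v : ℝ)) (selected_subset G π k d A)
  simp only [integral_const, probReal_univ, one_smul]
  rw [← hHdef] at h2 h3
  -- At most the rejected half and, in expectation, half of the selected demand remain. With the
  -- selected part at least one half, this is at most `3/4`.
  linarith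

end Coins

/-! ### All rounds of `Allocate(1)`: decay and almost sure termination. -/

section MultipleRounds

open ProbabilityTheory

variable {V : Type*} [Fintype V] [DecidableEq V] {k : ℕ} (G : ConflictGraph V) (π : Ordering V)

theorem active₁_congr (d : V → ℕ) {s s' : ℕ → V × Fin k → unitInterval} {t : ℕ}
    (h : ∀ i < t, s i = s' i) : active₁ G π d s t = active₁ G π d s' t := by
  induction t with
  | zero => rfl
  | succ t ih =>
    rw [active₁, active₁, ih fun i hi => h i (hi.trans t.lt_succ_self), h t t.lt_succ_self]

theorem measurable_sdiff_served (d : V → ℕ) :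
    Measurable fun p : Finset V × (V × Fin k → unitInterval) => p.1 \ served G π d p.1 p.2 :=
  measurable_from_prod_countable_right fun A =>
    (measurable_of_countable fun B : Finset V => A \ B).comp (measurable_served G π d A)

omit [Fintype V] [DecidableEq V] in
theorem measurable_toss (t : ℕ) :
    Measurable fun s : ℕ → V × Fin k → unitInterval => s t := measurable_pi_apply t

theorem measurable_active₁ (d : V → ℕ) (t : ℕ) :
    Measurable fun s : ℕ → V × Fin k → unitInterval => active₁ G π d s t := by
  induction t with
  | zero => exact measurable_const
  | succ t ih =>
    have h := (measurable_sdiff_served G π d).comp (ih.prodMk (measurable_toss t))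
    exact h

/-- The law of the tosses of all rounds. -/
noncomputable abbrev tossLaw (V : Type*) [Fintype V] (k : ℕ) :
    Measure (ℕ → V × Fin k → unitInterval) :=
  Measure.infinitePi fun _ => volume

theorem indepFun_active₁ (d : V → ℕ) (t : ℕ) :
    IndepFun (fun s : ℕ → V × Fin k → unitInterval => active₁ G π d s t) (fun s => s t)
      (tossLaw V k) := by
  have hind : iIndepFun (fun t (s : ℕ → V × Fin k → unitInterval) => s t) (tossLaw V k) :=
    iIndepFun_infinitePi (X := fun _ s => s) fun _ => measurable_id
  -- Padding by zeros exhibits `V_t` as a function of the tosses of the first `t` rounds only.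
  set ext : (Finset.range t → V × Fin k → unitInterval) → ℕ → V × Fin k → unitInterval :=
    fun w i => if h : i ∈ Finset.range t then w ⟨i, h⟩ else 0 with hext
  have hextm : Measurable ext := by
    refine measurable_pi_lambda _ fun i => ?_
    by_cases h : i ∈ Finset.range t
    · simp only [hext, dif_pos h]; fun_prop
    · simp only [hext, dif_neg h]; fun_prop
  have h := (hind.indepFun_finset (Finset.range t) {t} (by simp) fun _ => measurable_pi_apply _
    ).comp ((measurable_active₁ G π d t).comp hextm)
      (measurable_pi_apply (⟨t, Finset.mem_singleton_self t⟩ : ({t} : Finset ℕ)))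
  refine h.congr (.of_forall fun s => ?_) (.of_forall fun s => rfl)
  refine active₁_congr G π d fun i hi => ?_
  simp [hext, hi]

omit [DecidableEq V] in
theorem integrable_sum_finset {Ω : Type*} [MeasurableSpace Ω] {μ : Measure Ω} [IsFiniteMeasure μ]
    (f : V → ℝ) {A : Ω → Finset V} (hA : Measurable A) :
    Integrable (fun ω => ∑ v ∈ A ω, f v) μ := by
  refine Integrable.of_bound ((measurable_of_countable fun B : Finset V => ∑ v ∈ B, f v).comp
    hA).aestronglyMeasurable (∑ v, ‖f v‖) (.of_forall fun ω => ?_)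
  exact (norm_sum_le _ _).trans (Finset.sum_le_sum_of_subset_of_nonneg (Finset.subset_univ _)
    fun _ _ _ => norm_nonneg _)

/-- The expected total demand of the active users of `Allocate(1)` decays geometrically. -/
theorem integral_sum_active₁_le (hk : 0 < k) {d : V → ℕ} (hd : Admissible G π k d)
    (hd' : ∀ u, (d u : ℝ) ≤ k / 8) (t : ℕ) :
    ∫ s, ∑ v ∈ active₁ G π d s t, (d v : ℝ) ∂tossLaw V k ≤ (3 / 4) ^ t * ∑ v, (d v : ℝ) := by
  induction t with
  | zero => simp [active₁]
  | succ t ih =>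
    have hA := measurable_active₁ (k := k) G π d t
    -- `V_t` is independent of the tosses of round `t`, so the one-round bound applies with `V_t`
    -- held fixed.
    have hmap : (tossLaw V k).map (fun s => (active₁ G π d s t, s t))
        = ((tossLaw V k).map fun s => active₁ G π d s t).prod volume := by
      rw [(indepFun_iff_map_prod_eq_prod_map_map hA.aemeasurable
        (measurable_toss t).aemeasurable).1 (indepFun_active₁ G π d t)]
      congr 1
      exact Measure.infinitePi_map_eval _ t
    have : IsProbabilityMeasure ((tossLaw V k).map fun s => active₁ G π d s t) :=
      Measure.isProbabilityMeasure_map hA.aemeasurable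
    set g : Finset V × (V × Fin k → unitInterval) → ℝ := fun p =>
      ∑ v ∈ p.1 \ served G π d p.1 p.2, (d v : ℝ) with hg
    have hgm : Measurable g := (measurable_of_countable fun B : Finset V =>
      ∑ v ∈ B, (d v : ℝ)).comp (measurable_sdiff_served G π d)
    have hgI : Integrable g (((tossLaw V k).map fun s => active₁ G π d s t).prod volume) :=
      integrable_sum_finset _ (measurable_sdiff_served G π d)
    calc ∫ s, ∑ v ∈ active₁ G π d s (t + 1), (d v : ℝ) ∂tossLaw V k
        = ∫ s, g (active₁ G π d s t, s t) ∂tossLaw V k := rfl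
      _ = ∫ p, g p ∂(tossLaw V k).map (fun s => (active₁ G π d s t, s t)) :=
          (integral_map (hA.prodMk (measurable_toss t)).aemeasurable
            hgm.aestronglyMeasurable).symm
      _ = ∫ A, ∫ s, g (A, s) ∂volume ∂((tossLaw V k).map fun s => active₁ G π d s t) := by
          rw [hmap, integral_prod _ hgI]
      _ ≤ ∫ A, 3 / 4 * ∑ v ∈ A, (d v : ℝ) ∂((tossLaw V k).map fun s => active₁ G π d s t) :=
          integral_mono hgI.integral_prod_left
            ((integrable_sum_finset (A := id) _ measurable_id).const_mul _)
            fun A => integral_sum_sdiff_served_le G π hk hd hd' A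
      _ = 3 / 4 * ∫ s, ∑ v ∈ active₁ G π d s t, (d v : ℝ) ∂tossLaw V k := by
          rw [integral_const_mul, integral_map hA.aemeasurable
            (measurable_of_countable _).aestronglyMeasurable]
      _ ≤ (3 / 4) ^ (t + 1) * ∑ v, (d v : ℝ) := by
          rw [pow_succ]; linarith

/-- A nonzero total demand is at least one, so Markov's inequality applies. -/
theorem measureReal_sum_active₁_ne_zero_le (hk : 0 < k) {d : V → ℕ} (hd : Admissible G π k d)
    (hd' : ∀ u, (d u : ℝ) ≤ k / 8) (t : ℕ) :
    (tossLaw V k).real {s | ∑ v ∈ active₁ G π d s t, d v ≠ 0}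
      ≤ (3 / 4) ^ t * ∑ v, (d v : ℝ) := by
  have h := mul_meas_ge_le_integral_of_nonneg (μ := tossLaw V k)
    (f := fun s => ∑ v ∈ active₁ G π d s t, (d v : ℝ))
    (.of_forall fun s => Finset.sum_nonneg fun _ _ => Nat.cast_nonneg _)
    (integrable_sum_finset _ (measurable_active₁ G π d t)) 1
  rw [one_mul] at h
  refine le_trans (measureReal_mono ?_) (h.trans (integral_sum_active₁_le G π hk hd hd' t))
  intro s hs
  have hs' : ∑ v ∈ active₁ G π d s t, d v ≠ 0 := hs
  have : 1 ≤ ∑ v ∈ active₁ G π d s t, d v := Nat.one_le_iff_ne_zero.2 hs'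
  show (1 : ℝ) ≤ ∑ v ∈ active₁ G π d s t, (d v : ℝ)
  exact_mod_cast this

theorem ae_active₁_eq_empty (hk : 0 < k) {d : V → ℕ} (hd : Admissible G π k d)
    (hd' : ∀ u, (d u : ℝ) ≤ k / 8) :
    ∀ᵐ s ∂tossLaw V k, ∃ t, active₁ G π d s t = ∅ := by
  have hsub : {s : ℕ → V × Fin k → unitInterval | ¬ ∃ t, active₁ G π d s t = ∅}
      ⊆ ⋂ t, {s | ∑ v ∈ active₁ G π d s t, d v ≠ 0} := by
    intro s hs
    rw [Set.mem_iInter]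
    intro t h
    exact hs ⟨t + 1, active₁_succ_eq_empty G π hk d s h⟩
  rw [ae_iff, ← measureReal_eq_zero_iff]
  refine le_antisymm ?_ measureReal_nonneg
  have hlim : Filter.Tendsto (fun t : ℕ => (3 / 4 : ℝ) ^ t * ∑ v, (d v : ℝ)) Filter.atTop
      (nhds 0) := by
    simpa using (tendsto_pow_atTop_nhds_zero_of_lt_one (by norm_num) (by norm_num)).mul_const
      (∑ v, (d v : ℝ))
  refine ge_of_tendsto' hlim fun t => le_trans (measureReal_mono ?_)
    (measureReal_sum_active₁_ne_zero_le G π hk hd hd' t)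
  exact hsub.trans (Set.iInter_subset _ t)

/-! ### Measurability: all intermediate objects take countably many values. -/

section Measurability

variable (b : V → Finset (Fin k) → ℝ) (σ : Selector V k)

theorem measurable_round₁ (d : V → ℕ) (t : ℕ) :
    Measurable fun s : ℕ → V × Fin k → unitInterval => round₁ G π σ d s t := by
  refine measurable_pi_lambda _ fun v => ?_
  have hA : ∀ A : Finset V, Measurable fun w : V × Fin k → unitInterval =>
      if v ∈ served G π d A w then
        σ.pick t v (d v) (successes G d (selected G π k d A) w v) else ∅ := by
    intro A
    have h1 := (measurable_of_countable fun T : Finset (Fin k) => σ.pick t v (d v) T).comp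
      (measurable_successes G d (selected G π k d A) v)
    exact Measurable.ite
      (measurableSet_setOfPred.2 (measurable_finset_iff.1 (measurable_served G π d A) v)) h1
      measurable_const
  have h2 : Measurable fun p : Finset V × (V × Fin k → unitInterval) =>
      if v ∈ served G π d p.1 p.2 then
        σ.pick t v (d v) (successes G d (selected G π k d p.1) p.2 v) else ∅ :=
    measurable_from_prod_countable_right hA
  have h3 := h2.comp ((measurable_active₁ G π d t).prodMk (measurable_toss t))
  exact h3

omit [DecidableEq V] in
theorem measurable_bestOf {Ω : Type*} [MeasurableSpace Ω] {S : Ω → ℕ → Allocation V k}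
    (hS : ∀ t, Measurable fun ω => S ω t) (n : ℕ) : Measurable fun ω => bestOf b (S ω) n := by
  induction n with
  | zero => exact hS 0
  | succ n ih =>
    exact (measurable_of_countable fun p : Allocation V k × Allocation V k =>
      if welfare b p.1 < welfare b p.2 then p.2 else p.1).comp (ih.prodMk (hS (n + 1)))

omit [DecidableEq V] in
theorem measurable_numRounds {Ω : Type*} [MeasurableSpace Ω] {A : Ω → ℕ → Finset V}
    (hA : ∀ t, Measurable fun ω => A ω t) : Measurable fun ω => numRounds (A ω) := by
  have hE : ∀ t, MeasurableSet {ω | A ω t = ∅} := fun t => hA t (measurableSet_singleton ∅)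
  refine measurable_to_countable' fun n => ?_
  -- The second event covers loops that never stop, where the infimum is `0` by convention.
  have : (fun ω => numRounds (A ω)) ⁻¹' {n}
      = ({ω | A ω n = ∅} ∩ ⋂ m ∈ Finset.range n, {ω | A ω m = ∅}ᶜ)
        ∪ ({_ω | n = 0} ∩ ⋂ m, {ω | A ω m = ∅}ᶜ) := by
    ext ω
    simp only [Set.mem_preimage, Set.mem_singleton_iff, Set.mem_union, Set.mem_inter_iff,
      Set.mem_iInter, Set.mem_compl_iff, Finset.mem_range, Set.mem_ofPred_eq, numRounds]
    constructor
    · rintro rfl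
      by_cases h : ∃ t, A ω t = ∅
      · exact Or.inl ⟨Nat.sInf_mem (s := {t | A ω t = ∅}) h,
          fun m hm hm' => Nat.notMem_of_lt_sInf hm hm'⟩
      · rw [not_exists] at h
        exact Or.inr ⟨Nat.sInf_eq_zero.2 (Or.inr (Set.eq_empty_of_forall_notMem h)), h⟩
    · rintro (⟨h, h'⟩ | ⟨rfl, h⟩)
      · refine le_antisymm (Nat.sInf_le h) ?_
        by_contra! hlt
        exact h' _ hlt (Nat.sInf_mem (s := {t | A ω t = ∅}) ⟨n, h⟩)
      · exact Nat.sInf_eq_zero.2 (Or.inr (Set.eq_empty_of_forall_notMem h))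
  rw [this]
  exact ((hE n).inter (.biInter (Finset.range n).countable_toSet fun m _ => (hE m).compl)).union
    ((MeasurableSet.const _).inter (.iInter fun m => (hE m).compl))

theorem measurable_allocate₁ (d : V → ℕ) :
    Measurable fun s : ℕ → V × Fin k → unitInterval => allocate₁ G π b σ d s := by
  have : Measurable fun p : (ℕ → V × Fin k → unitInterval) × ℕ =>
      bestOf b (round₁ G π σ d p.1) (p.2 - 1) :=
    measurable_from_prod_countable_left fun n =>
      measurable_bestOf b (measurable_round₁ G π σ d) (n - 1)
  have h := this.comp (measurable_id.prodMk (measurable_numRounds (measurable_active₁ G π d)))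
  exact h

end Measurability

end MultipleRounds

/-! ### Number of rounds, expectations and the final constant. -/

section Expectation

variable {V : Type*} [Fintype V] [DecidableEq V] {k : ℕ} {G : ConflictGraph V} {π : Ordering V}

theorem exists_numRounds_bound {n k : ℕ} (h : 1 < n * k) :
    ∃ T : ℕ, (3 / 4 : ℝ) ^ T * (n * k) ≤ 1 / 2 ∧
      (T + 1 : ℝ) ≤ 12 * (Real.log n + Real.log k) := by
  have hn : (n : ℝ) ≠ 0 := by rintro h0; simp_all
  have hk : (k : ℝ) ≠ 0 := by rintro h0; simp_all
  have hN : (2 : ℝ) ≤ n * k := by exact_mod_cast h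
  set N : ℝ := n * k with hNdef
  have hN0 : 0 < N := by linarith
  have hL : Real.log n + Real.log k = Real.log N := (Real.log_mul hn hk).symm
  have hlog2 : (1 / 2 : ℝ) ≤ Real.log 2 := by
    have := Real.one_sub_inv_le_log_of_pos (x := 2) (by norm_num); linarith
  have hlog : Real.log 2 ≤ Real.log N := Real.log_le_log (by norm_num) hN
  -- Since `3/4 ≤ exp (-1/4)`, this many rounds give a factor of at most `1/(2N)`. As `log N ≥ log 2
  -- ≥ 1/2`, the additive terms `4 log 2` and `2` are each at most `4 log N`, whence `12`.
  refine ⟨⌈4 * Real.log (2 * N)⌉₊, ?_, ?_⟩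
  · have h1 : 4 * Real.log (2 * N) ≤ ⌈4 * Real.log (2 * N)⌉₊ := Nat.le_ceil _
    set T := ⌈4 * Real.log (2 * N)⌉₊
    have h2 : (3 / 4 : ℝ) ≤ Real.exp (-(1 / 4)) := by
      have := Real.add_one_le_exp (-(1 / 4) : ℝ); linarith
    have h3 : (3 / 4 : ℝ) ^ T ≤ (2 * N)⁻¹ := by
      calc (3 / 4 : ℝ) ^ T ≤ Real.exp (-(1 / 4)) ^ T := pow_le_pow_left₀ (by norm_num) h2 T
        _ = Real.exp (T * -(1 / 4)) := (Real.exp_nat_mul _ _).symm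
        _ ≤ Real.exp (-Real.log (2 * N)) := Real.exp_le_exp.2 (by linarith)
        _ = (2 * N)⁻¹ := by rw [Real.exp_neg, Real.exp_log (by linarith)]
    calc (3 / 4 : ℝ) ^ T * N ≤ (2 * N)⁻¹ * N := mul_le_mul_of_nonneg_right h3 hN0.le
      _ = 1 / 2 := by field_simp
  · have h1 := (Nat.ceil_lt_add_one (a := 4 * Real.log (2 * N))
      (mul_nonneg (by norm_num) (Real.log_nonneg (by linarith)))).le
    have h2 : Real.log (2 * N) = Real.log 2 + Real.log N :=
      Real.log_mul (by norm_num) hN0.ne'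
    rw [hL]
    linarith

omit [DecidableEq V] in
theorem sum_demand_le {d : V → ℕ} (hd : ∀ u, d u ≤ k) :
    ∑ v, (d v : ℝ) ≤ Fintype.card V * k := by
  calc ∑ v, (d v : ℝ) ≤ ∑ _v : V, (k : ℝ) := Finset.sum_le_sum fun v _ => by exact_mod_cast hd v
    _ = Fintype.card V * k := by simp

theorem exists_active₂_eq_empty (hk : 0 < k) {d : V → ℕ} (hd : Admissible G π k d) {T : ℕ}
    (hT : (1 / 2 : ℝ) ^ T * ∑ v, (d v : ℝ) < 1) : active₂ G π k d (T + 1) = ∅ := by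
  refine active₂_succ_eq_empty G π hk d ?_
  have h := (sum_active₂_le G π hk hd T).trans_lt hT
  have h' : ∑ v ∈ active₂ G π k d T, d v < 1 := by exact_mod_cast h
  omega

theorem terminates_allocate₂ (hk : 0 < k) {d : V → ℕ} (hd : Admissible G π k d) :
    ∃ t, active₂ G π k d t = ∅ := by
  have hlim : Filter.Tendsto (fun t : ℕ => (1 / 2 : ℝ) ^ t * ∑ v, (d v : ℝ)) Filter.atTop
      (nhds 0) := by
    simpa using (tendsto_pow_atTop_nhds_zero_of_lt_one (r := (1 / 2 : ℝ)) (by norm_num)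
      (by norm_num)).mul_const (∑ v, (d v : ℝ))
  obtain ⟨T, hT⟩ := (hlim.eventually_lt_const one_pos).exists
  exact ⟨T + 1, exists_active₂_eq_empty hk hd hT⟩

theorem welfare_le_sum {b : V → Finset (Fin k) → ℝ} (hb : ∀ v T, 0 ≤ b v T)
    (S : Allocation V k) : welfare b S ≤ ∑ S' : Allocation V k, welfare b S' :=
  Finset.single_le_sum (f := fun S' : Allocation V k => welfare b S')
    (fun S' _ => welfare_nonneg hb S') (Finset.mem_univ S)

theorem integrable_welfare {Ω : Type*} [MeasurableSpace Ω] {μ : Measure Ω} [IsFiniteMeasure μ]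
    {b : V → Finset (Fin k) → ℝ} (hb : ∀ v T, 0 ≤ b v T) {S : Ω → Allocation V k}
    (hS : Measurable S) : Integrable (fun ω => welfare b (S ω)) μ :=
  Integrable.of_bound ((measurable_of_countable (welfare b)).comp hS).aestronglyMeasurable
    (∑ S' : Allocation V k, welfare b S') (.of_forall fun ω => by
      rw [Real.norm_of_nonneg (welfare_nonneg hb _)]; exact welfare_le_sum hb _)

/-- With probability at least `1/2` no positive demand is active after `T` rounds, and the best of
at most `T + 1` rounds has the average value. Otherwise the welfare is only bounded below by zero,
which costs the factor `2`. -/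
theorem le_integral_allocate₁ (hk : 0 < k) {d : V → ℕ} (hd : Admissible G π k d)
    (hd' : ∀ u, (d u : ℝ) ≤ k / 8) {b : V → Finset (Fin k) → ℝ} (hb : ∀ v T, 0 ≤ b v T)
    (hs : IsSymmetric b) (σ : Selector V k) {T : ℕ}
    (hT : (3 / 4 : ℝ) ^ T * (Fintype.card V * k) ≤ 1 / 2) :
    (∑ v, valueOf b v (d v)) / (2 * (T + 1)) ≤
      ∫ s, welfare b (allocate₁ G π b σ d s) ∂tossLaw V k := by
  have hB : 0 ≤ ∑ v, valueOf b v (d v) := Finset.sum_nonneg fun v _ => hb v _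
  set B := ∑ v, valueOf b v (d v)
  set E : Set (ℕ → V × Fin k → unitInterval) := {s | ∑ v ∈ active₁ G π d s T, d v ≠ 0} with hE
  have hEm : MeasurableSet E :=
    ((measurable_of_countable fun A : Finset V => ∑ v ∈ A, d v).comp
      (measurable_active₁ G π d T)) (measurableSet_singleton 0).compl
  have hPE : (tossLaw V k).real E ≤ 1 / 2 := by
    refine (measureReal_sum_active₁_ne_zero_le G π hk hd hd' T).trans (le_trans ?_ hT)
    refine mul_le_mul_of_nonneg_left (sum_demand_le fun u => ?_) (by positivity)
    have h1 := hd' u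
    have h2 : (0 : ℝ) ≤ k := Nat.cast_nonneg k
    have : (d u : ℝ) ≤ k := by linarith
    exact_mod_cast this
  have hPEc : 1 / 2 ≤ (tossLaw V k).real Eᶜ := by
    rw [probReal_compl_eq_one_sub hEm]; linarith
  calc B / (2 * (T + 1)) = 1 / 2 * (B / (T + 1)) := by field_simp
    _ ≤ (tossLaw V k).real Eᶜ * (B / (T + 1)) :=
        mul_le_mul_of_nonneg_right hPEc (by positivity)
    _ = ∫ s, Eᶜ.indicator (fun _ => B / (T + 1)) s ∂tossLaw V k := by
        rw [integral_indicator_const _ hEm.compl, smul_eq_mul]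
    _ ≤ ∫ s, welfare b (allocate₁ G π b σ d s) ∂tossLaw V k := by
        refine integral_mono ((integrable_const _).indicator hEm.compl)
          (integrable_welfare hb (measurable_allocate₁ G π b σ d)) fun s => ?_
        by_cases h : s ∈ E
        · rw [Set.indicator_of_notMem (Set.notMem_compl_iff.2 h)]
          exact welfare_nonneg hb _
        · rw [Set.indicator_of_mem h, div_le_iff₀ (by positivity), mul_comm]
          exact sum_valueOf_le_allocate₁ G π hb hs σ d s
            (active₁_succ_eq_empty G π hk d s (not_not.1 h))

theorem le_welfare_allocate₂ (hk : 0 < k) {d : V → ℕ} (hd : Admissible G π k d)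
    (hd' : ∀ u, d u ≤ k) {b : V → Finset (Fin k) → ℝ} (hb : ∀ v T, 0 ≤ b v T) {T : ℕ}
    (hT : (3 / 4 : ℝ) ^ T * (Fintype.card V * k) ≤ 1 / 2) :
    (∑ v, valueOf b v (d v)) / (T + 1) ≤ welfare b (allocate₂ G π b d) := by
  rw [div_le_iff₀ (by positivity), mul_comm]
  refine sum_valueOf_le_allocate₂ G π hb d (exists_active₂_eq_empty hk hd ?_)
  calc (1 / 2 : ℝ) ^ T * ∑ v, (d v : ℝ) ≤ (3 / 4) ^ T * (Fintype.card V * k) := by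
        refine mul_le_mul (pow_le_pow_left₀ (by norm_num) (by norm_num) T) (sum_demand_le hd')
          (Finset.sum_nonneg fun _ _ => Nat.cast_nonneg _) (by positivity)
    _ < 1 := by linarith

theorem welfare_output (b : V → Finset (Fin k) → ℝ) (σ : Selector V k) (r : RandomInput V k) :
    welfare b (output G π b σ r)
      = max (welfare b (smallResult G π b σ r)) (welfare b (largeResult G π b r)) := by
  rw [output]
  split_ifs with h
  · rw [max_eq_right h.le]
  · rw [max_eq_left (not_lt.1 h)]

theorem measurable_smallResult (b : V → Finset (Fin k) → ℝ) (σ : Selector V k) :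
    Measurable fun p : (V → ℕ) × (ℕ → V × Fin k → unitInterval) =>
      allocate₁ G π b σ (demand G π k p.1) p.2 :=
  measurable_from_prod_countable_right fun r => measurable_allocate₁ G π b σ (demand G π k r)

variable {ρ : ℝ} {x : V → ℕ → ℝ}

theorem ae_smallPart_demand (hρ : 1 / 64 ≤ ρ) (hx : LPFeasible G π ρ k x) :
    ∀ᵐ r ∂Measure.pi fun v => drawLaw k ρ (smallPart k x v),
      ∀ v, (demand G π k r v : ℝ) ≤ k / 8 := by
  refine ae_demand hρ hx.smallPart (fun n => (n : ℝ) ≤ k / 8) (by simp; positivity)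
    fun v i _ h => ?_
  by_contra h'
  exact h (if_neg h')

theorem ae_largePart_demand (hρ : 1 / 64 ≤ ρ) (hx : LPFeasible G π ρ k x) :
    ∀ᵐ r ∂Measure.pi fun v => drawLaw k ρ (largePart k x v),
      ∀ v, demand G π k r v ≤ k ∧ (demand G π k r v ≠ 0 → (k : ℝ) / 8 < demand G π k r v) := by
  refine ae_demand hρ hx.largePart (fun n => n ≤ k ∧ (n ≠ 0 → (k : ℝ) / 8 < n)) (by simp)
    fun v i hi h => ⟨(Finset.mem_Icc.1 hi).2, fun _ => ?_⟩
  by_contra! h'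
  exact h (by rw [largePart, smallPart, if_pos h', sub_self])

omit [DecidableEq V] in
theorem isProbabilityMeasure_randomLaw (hρ : 1 / 64 ≤ ρ) (hx : LPFeasible G π ρ k x) :
    IsProbabilityMeasure (randomLaw k ρ x) := by
  have := fun v => hx.smallPart.isProbabilityMeasure hρ v
  have := fun v => hx.largePart.isProbabilityMeasure hρ v
  rw [randomLaw]
  infer_instance

theorem ae_terminates_and_isFeasible (hk : 0 < k) (hρ : 1 / 64 ≤ ρ) (hx : LPFeasible G π ρ k x)
    (b : V → Finset (Fin k) → ℝ) (σ : Selector V k) :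
    ∀ᵐ r ∂randomLaw k ρ x, Terminates G π r ∧ G.IsFeasible (output G π b σ r) := by
  have := fun v => hx.smallPart.isProbabilityMeasure hρ v
  have := fun v => hx.largePart.isProbabilityMeasure hρ v
  -- There are countably many demand vectors, so one null set of tosses serves all of them.
  have hτ : ∀ᵐ s ∂tossLaw V k, ∀ d : V → ℕ, Admissible G π k d → (∀ u, (d u : ℝ) ≤ k / 8) →
      ∃ t, active₁ G π d s t = ∅ := by
    rw [ae_all_iff]
    intro d
    by_cases h : Admissible G π k d ∧ ∀ u, (d u : ℝ) ≤ k / 8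
    · filter_upwards [ae_active₁_eq_empty G π hk h.1 h.2] with s hs _ _ using hs
    · exact .of_forall fun s h1 h2 => absurd ⟨h1, h2⟩ h
  have h1 : ∀ᵐ r ∂randomLaw k ρ x, ∀ v, (demand G π k r.1 v : ℝ) ≤ k / 8 :=
    Measure.quasiMeasurePreserving_fst.ae (ae_smallPart_demand hρ hx)
  have h2 : ∀ᵐ r ∂randomLaw k ρ x, ∀ v, demand G π k r.2.1 v ≤ k ∧
      (demand G π k r.2.1 v ≠ 0 → (k : ℝ) / 8 < demand G π k r.2.1 v) :=
    Measure.quasiMeasurePreserving_snd.ae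
      (Measure.quasiMeasurePreserving_fst.ae (ae_largePart_demand hρ hx))
  have h3 : ∀ᵐ r ∂randomLaw k ρ x, ∀ d : V → ℕ, Admissible G π k d →
      (∀ u, (d u : ℝ) ≤ k / 8) → ∃ t, active₁ G π d r.2.2 t = ∅ :=
    Measure.quasiMeasurePreserving_snd.ae (Measure.quasiMeasurePreserving_snd.ae hτ)
  filter_upwards [h1, h2, h3] with r hr1 hr2 hr3
  refine ⟨⟨hr3 _ (admissible_demand G π k _) hr1,
    terminates_allocate₂ hk (admissible_demand G π k _)⟩, ?_⟩
  rw [output]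
  split_ifs
  · exact allocate₂_feasible G π hk b (admissible_demand G π k _) fun v => (hr2 v).2
  · exact allocate₁_feasible G π b σ _ _

theorem integrable_smallResult (hρ : 1 / 64 ≤ ρ) (hx : LPFeasible G π ρ k x)
    {b : V → Finset (Fin k) → ℝ} (hb : ∀ v T, 0 ≤ b v T) (σ : Selector V k) :
    Integrable (fun r => welfare b (smallResult G π b σ r)) (randomLaw k ρ x) := by
  have := isProbabilityMeasure_randomLaw hρ hx
  have h : Measurable fun r : RandomInput V k => (r.1, r.2.2) := by fun_prop
  have h' := (measurable_smallResult (G := G) (π := π) b σ).comp h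
  exact integrable_welfare hb h'

theorem integrable_largeResult (hρ : 1 / 64 ≤ ρ) (hx : LPFeasible G π ρ k x)
    {b : V → Finset (Fin k) → ℝ} (hb : ∀ v T, 0 ≤ b v T) :
    Integrable (fun r => welfare b (largeResult G π b r)) (randomLaw k ρ x) := by
  have := isProbabilityMeasure_randomLaw hρ hx
  have h : Measurable fun r : RandomInput V k => r.2.1 := by fun_prop
  have h' := (measurable_of_countable fun r => allocate₂ G π b (demand G π k r)).comp h
  exact integrable_welfare hb h'

theorem le_integral_smallResult (hk : 0 < k) (hρ : 1 / 64 ≤ ρ) (hx : LPFeasible G π ρ k x)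
    {b : V → Finset (Fin k) → ℝ} (hb : ∀ v T, 0 ≤ b v T) (hs : IsSymmetric b)
    (σ : Selector V k) {T : ℕ} (hT : (3 / 4 : ℝ) ^ T * (Fintype.card V * k) ≤ 1 / 2) :
    lpValue b (smallPart k x) / (128 * ρ) / (2 * (T + 1)) ≤
      ∫ r, welfare b (smallResult G π b σ r) ∂randomLaw k ρ x := by
  have := fun v => hx.smallPart.isProbabilityMeasure hρ v
  have := fun v => hx.largePart.isProbabilityMeasure hρ v
  have hint := integrable_smallResult hρ hx hb σ
  set μ₁ := Measure.pi fun v => drawLaw k ρ (smallPart k x v) with hμ₁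
  set μ₂ := Measure.pi fun v => drawLaw k ρ (largePart k x v) with hμ₂
  -- The draws for `x⁽²⁾` integrate out, and the tosses are integrated with the demands fixed.
  have hfub : ∫ r, welfare b (smallResult G π b σ r) ∂randomLaw k ρ x
      = ∫ r₁, ∫ s, welfare b (allocate₁ G π b σ (demand G π k r₁) s) ∂tossLaw V k ∂μ₁ := by
    rw [randomLaw] at hint ⊢
    rw [integral_prod _ hint]
    refine integral_congr_ae (.of_forall fun r₁ => ?_)
    have := integral_fun_snd (μ := μ₂) (ν := tossLaw V k)
      fun s => welfare b (allocate₁ G π b σ (demand G π k r₁) s)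
    rw [probReal_univ, one_smul] at this
    exact this
  have hinner : Integrable (fun r₁ =>
      ∫ s, welfare b (allocate₁ G π b σ (demand G π k r₁) s) ∂tossLaw V k) μ₁ :=
    (integrable_welfare (μ := μ₁.prod (tossLaw V k)) hb
      (measurable_smallResult (G := G) (π := π) b σ)).integral_prod_left
  rw [hfub]
  calc lpValue b (smallPart k x) / (128 * ρ) / (2 * (T + 1))
      ≤ (∫ r, ∑ v, valueOf b v (demand G π k r v) ∂μ₁) / (2 * (T + 1)) := by
        gcongr
        exact lpValue_le_integral_demand hk hρ hx.smallPart hb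
    _ = ∫ r, (∑ v, valueOf b v (demand G π k r v)) / (2 * (T + 1)) ∂μ₁ :=
        (integral_div _ _).symm
    _ ≤ _ := by
        refine integral_mono_ae ((integrable_finsetSum _ fun v _ =>
          integrable_comp_demand hρ hx.smallPart (valueOf b v) v).div_const _) hinner ?_
        filter_upwards [ae_smallPart_demand hρ hx] with r hr
        exact le_integral_allocate₁ hk (admissible_demand G π k r) hr hb hs σ hT

theorem le_integral_largeResult (hk : 0 < k) (hρ : 1 / 64 ≤ ρ) (hx : LPFeasible G π ρ k x)
    {b : V → Finset (Fin k) → ℝ} (hb : ∀ v T, 0 ≤ b v T) {T : ℕ}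
    (hT : (3 / 4 : ℝ) ^ T * (Fintype.card V * k) ≤ 1 / 2) :
    lpValue b (largePart k x) / (128 * ρ) / (T + 1) ≤
      ∫ r, welfare b (largeResult G π b r) ∂randomLaw k ρ x := by
  have := fun v => hx.smallPart.isProbabilityMeasure hρ v
  have := fun v => hx.largePart.isProbabilityMeasure hρ v
  set μ₁ := Measure.pi fun v => drawLaw k ρ (smallPart k x v) with hμ₁
  set μ₂ := Measure.pi fun v => drawLaw k ρ (largePart k x v) with hμ₂
  have hfub : ∫ r, welfare b (largeResult G π b r) ∂randomLaw k ρ x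
      = ∫ r₂, welfare b (allocate₂ G π b (demand G π k r₂)) ∂μ₂ := by
    have h1 := integral_fun_snd (μ := μ₁) (ν := μ₂.prod (tossLaw V k))
      fun q => welfare b (allocate₂ G π b (demand G π k q.1))
    have h2 := integral_fun_fst (μ := μ₂) (ν := tossLaw V k)
      fun r₂ => welfare b (allocate₂ G π b (demand G π k r₂))
    rw [probReal_univ, one_smul] at h1 h2
    exact h1.trans h2
  rw [hfub]
  calc lpValue b (largePart k x) / (128 * ρ) / (T + 1)
      ≤ (∫ r, ∑ v, valueOf b v (demand G π k r v) ∂μ₂) / (T + 1) := by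
        gcongr
        exact lpValue_le_integral_demand hk hρ hx.largePart hb
    _ = ∫ r, (∑ v, valueOf b v (demand G π k r v)) / (T + 1) ∂μ₂ :=
        (integral_div _ _).symm
    _ ≤ _ := by
        refine integral_mono_ae ((integrable_finsetSum _ fun v _ =>
          integrable_comp_demand hρ hx.largePart (valueOf b v) v).div_const _)
          (integrable_welfare hb (measurable_of_countable _)) ?_
        filter_upwards [ae_largePart_demand hρ hx] with r hr
        exact le_welfare_allocate₂ hk (admissible_demand G π k r) (fun u => (hr u).1) hb hT

theorem integrable_output (hρ : 1 / 64 ≤ ρ) (hx : LPFeasible G π ρ k x)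
    {b : V → Finset (Fin k) → ℝ} (hb : ∀ v T, 0 ≤ b v T) (σ : Selector V k) :
    Integrable (fun r => welfare b (output G π b σ r)) (randomLaw k ρ x) := by
  simp only [welfare_output]
  exact (integrable_smallResult hρ hx hb σ).sup (integrable_largeResult hρ hx hb)

omit [DecidableEq V] in
theorem lpValue_nonneg (hx : LPFeasible G π ρ k x) {b : V → Finset (Fin k) → ℝ}
    (hb : ∀ v T, 0 ≤ b v T) : 0 ≤ lpValue b x :=
  Finset.sum_nonneg fun v _ => Finset.sum_nonneg fun i hi => mul_nonneg (hb v _) (hx.nonneg v i hi)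

theorem le_integral_output (hk : 0 < k) (hρ : 1 / 64 ≤ ρ) (hx : LPFeasible G π ρ k x)
    {b : V → Finset (Fin k) → ℝ} (hb : ∀ v T, 0 ≤ b v T) (hs : IsSymmetric b)
    (σ : Selector V k) (hnk : 1 < Fintype.card V * k) :
    1 / 6144 * lpValue b x / (ρ * (Real.log (Fintype.card V) + Real.log k)) ≤
      ∫ r, welfare b (output G π b σ r) ∂randomLaw k ρ x := by
  obtain ⟨T, hT, hTL⟩ := exists_numRounds_bound hnk
  set L := Real.log (Fintype.card V) + Real.log k
  have hρ0 : 0 < ρ := by linarith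
  have hT0 : (0 : ℝ) < T + 1 := by positivity
  have h1 := le_integral_smallResult hk hρ hx hb hs σ hT
  have h2 := le_integral_largeResult hk hρ hx hb hT
  have hI1 := integrable_smallResult hρ hx hb σ
  have hI2 := integrable_largeResult hρ hx hb
  have hI := integrable_output hρ hx hb σ
  have hp1 := lpValue_nonneg hx.smallPart hb
  have hp2 := lpValue_nonneg hx.largePart hb
  have hx0 := lpValue_nonneg hx hb
  have h3 : ∫ r, welfare b (smallResult G π b σ r) ∂randomLaw k ρ x
      ≤ ∫ r, welfare b (output G π b σ r) ∂randomLaw k ρ x :=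
    integral_mono hI1 hI fun r => by
      simp only [welfare_output]; exact le_max_left _ _
  have h4 : ∫ r, welfare b (largeResult G π b r) ∂randomLaw k ρ x
      ≤ ∫ r, welfare b (output G π b σ r) ∂randomLaw k ρ x :=
    integral_mono hI2 hI fun r => by
      simp only [welfare_output]; exact le_max_right _ _
  have h5 : lpValue b (largePart k x) / (128 * ρ) / (2 * (T + 1))
      ≤ lpValue b (largePart k x) / (128 * ρ) / (T + 1) := by
    gcongr
    linarith
  have h6 : lpValue b x / (128 * ρ) / (2 * (T + 1))
      = lpValue b (smallPart k x) / (128 * ρ) / (2 * (T + 1))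
        + lpValue b (largePart k x) / (128 * ρ) / (2 * (T + 1)) := by
    rw [← lpValue_small_add_large b x]; ring
  -- `6144 = 128 * 2 * 12 * 2`: rounding, the failure event of `Allocate(1)`, the number of rounds,
  -- and the maximum against the average of the two results.
  calc 1 / 6144 * lpValue b x / (ρ * L)
      = lpValue b x / (128 * ρ) / (2 * (12 * L)) / 2 := by
        rw [div_div, div_div, mul_comm (1 / 6144 : ℝ), mul_one_div, div_div]
        congr 1
        ring
    _ ≤ lpValue b x / (128 * ρ) / (2 * (T + 1)) / 2 := by gcongr
    _ ≤ ∫ r, welfare b (output G π b σ r) ∂randomLaw k ρ x := by linarith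

end Expectation

end SpectrumAuction

/-- The probability measure and integrability clauses make the Bochner integral a genuine
expectation rather than a default value. -/
theorem mainTheorem2 :
    ∃ c : ℝ, 0 < c ∧
      ∀ (V : Type*) [Fintype V] [DecidableEq V] (k : ℕ)
        (G : SpectrumAuction.ConflictGraph V) (π : SpectrumAuction.Ordering V) (ρ : ℝ)
        (b : V → Finset (Fin k) → ℝ) (x : V → ℕ → ℝ) (σ : SpectrumAuction.Selector V k),
        0 < k →
        1 / 64 ≤ ρ →
        G.InductivelyBounded π ρ →
        (∀ v T, 0 ≤ b v T) →
        SpectrumAuction.IsSymmetric b →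
        SpectrumAuction.LPOptimal G π ρ b x →
        IsProbabilityMeasure (SpectrumAuction.randomLaw k ρ x) ∧
        (∀ᵐ r ∂SpectrumAuction.randomLaw k ρ x,
          SpectrumAuction.Terminates G π r ∧
            G.IsFeasible (SpectrumAuction.output G π b σ r)) ∧
        Integrable (fun r => SpectrumAuction.welfare b (SpectrumAuction.output G π b σ r))
          (SpectrumAuction.randomLaw k ρ x) ∧
        (1 < Fintype.card V * k →
          c * SpectrumAuction.lpValue b x /
              (ρ * (Real.log (Fintype.card V) + Real.log k)) ≤
            ∫ r, SpectrumAuction.welfare b (SpectrumAuction.output G π b σ r)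
              ∂SpectrumAuction.randomLaw k ρ x) ∧
        ((∀ v, b v ∅ = 0) → ∀ S : SpectrumAuction.Allocation V k, G.IsFeasible S →
          SpectrumAuction.welfare b S ≤ SpectrumAuction.lpValue b x) := by
  refine ⟨1 / 6144, by norm_num, ?_⟩
  intro V _ _ k G π ρ b x σ hk hρ hG hb hs hx
  exact ⟨SpectrumAuction.isProbabilityMeasure_randomLaw hρ hx.1,
    SpectrumAuction.ae_terminates_and_isFeasible hk hρ hx.1 b σ,
    SpectrumAuction.integrable_output hρ hx.1 hb σ,
    SpectrumAuction.le_integral_output hk hρ hx.1 hb hs σ,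
    fun h0 S hS => SpectrumAuction.welfare_le_lpValue hG hs h0 hx hS⟩
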